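/- Let $n\ge 1$ and let $(M,\varphi,\xi,\eta,g)$ be a $(2n+1)$-dimensional almost contact complex Riemannian (accR) manifold: a smooth manifold $M$ with an endomorphism field $\varphi$, a vector field $\xi$, a 1-form $\eta$ and a pseudo-Riemannian metric $g$ of signature $(n+1,n)$, all smooth, such that $$\varphi\xi=0,\quad \varphi^2=-\mathrm{id}+\eta\otimes\xi,\quad \eta\circ\varphi=0,\quad \eta(\xi)=1,\quad g(\varphi x,\varphi y)=-g(x,y)+\eta(x)\eta(y).$$ Let $\tilde g(x,y)=g(x,\varphi y)+\eta(x)\eta(y)$ be the associated metric, $\nabla$ the Levi-Civita connection and $\rho$ the Ricci tensor of $g$, and $\tau$, $\tilde\tau$ the scalar curvatures of $g$ and $\tilde g$ (each for its own Levi-Civita connection). Suppose that the manifold is Sasaki-like, i.e. $$g\bigl((\nabla_x\varphi)y,z\bigr)=g(\varphi x,\varphi y)\eta(z)+g(\varphi x,\varphi z)\eta(y).$$ Let $\beta\in\mathbb R$, let $\vartheta$ be a smooth vector field and let $\lambda,\tilde\lambda,\psi,\tilde\psi$ be real functions on $M$. (a) Suppose that on $M$ the manifold is a $\beta$-Ricci–Bourguignon-like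 almost soliton with potential $\vartheta$, $$\rho+\tfrac12\mathcal L_\vartheta g+\tfrac12\mathcal L_\vartheta\tilde g+(\lambda+\beta\tau)g+(\tilde\lambda+\beta\tilde\tau)\tilde g=0,\qquad(1)$$ and that $\vartheta$ is conformal with respect to both metrics, $$\mathcal L_\vartheta g=2\psi g,\qquad \mathcal L_\vartheta\tilde g=2\tilde\psi\tilde g.\qquad(2)$$ Then the manifold is Einstein-like, i.e. $\rho=a\,g+b\,\tilde g+c\,\eta\otimes\eta$ for some real constants $a,b,c$, and on $M$ $$\rho=\Bigl(\frac{\tau}{2n}-1\Bigr)g+\Bigl(\frac{\tilde\tau}{2n}-1\Bigr)\tilde g,\qquad \tau+\tilde\tau=4n(n+1).\qquad(3)$$ If $\beta\ne-\frac1{2n}$, then $$\tau=-\frac{2n}{1+2n\beta}(\psi+\lambda-1),\quad \tilde\tau=-\frac{2n}{1+2n\beta}(\tilde\psi+\tilde\lambda-1),\quad \psi+\lambda+\tilde\psi+\tilde\lambda+2n[1+2(n+1)\beta]=0.\qquad(4)$$ If $\beta=-\frac1{2n}$, then $$\psi+\lambda=1,\qquad \tilde\psi+\tilde\lambda=1.\qquad(5)$$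 (b) The formulas hold pointwise: at every single point $p\in M$ at which (1) and (2) hold, (3) holds, and so does (4) if $\beta\ne-\frac1{2n}$, respectively (5) if $\beta=-\frac1{2n}$. -/

import Mathlib

open Bundle
open scoped Manifold ContDiff

noncomputable section

namespace AccR

/-! ### Pseudo-Riemannian geometry of a field of bilinear forms

Throughout, `M` is a manifold modelled on `ℝᵐ`. A vector field is a dependent function
`X : ∀ p, TangentSpace (𝓡 m) p`, and a metric is a field `g` of bilinear forms on the tangent
spaces. The definitions below are the usual ones when `g` is smooth, symmetric and
nondegenerate. -/

section Metric

variable {m : ℕ} {M : Type*} [TopologicalSpace M]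
  [ChartedSpace (EuclideanSpace ℝ (Fin m)) M] [IsManifold (𝓡 m) ∞ M]

/-- A (not necessarily smooth) vector field on `M`. -/
abbrev VField (m : ℕ) (M : Type*) [TopologicalSpace M]
    [ChartedSpace (EuclideanSpace ℝ (Fin m)) M] : Type _ :=
  ∀ p : M, TangentSpace (𝓡 m) p

/-- A field of bilinear forms on the tangent spaces of `M`. -/
abbrev Bilin (m : ℕ) (M : Type*) [TopologicalSpace M]
    [ChartedSpace (EuclideanSpace ℝ (Fin m)) M] : Type _ :=
  ∀ p : M, TangentSpace (𝓡 m) p →L[ℝ] TangentSpace (𝓡 m) p →L[ℝ] ℝ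

/-- Smoothness of a vector field. -/
def SmoothVField (X : VField m M) : Prop :=
  ContMDiff (𝓡 m) ((𝓡 m).prod 𝓘(ℝ, EuclideanSpace ℝ (Fin m))) ∞
    (fun p => TotalSpace.mk' (EuclideanSpace ℝ (Fin m)) (E := TangentSpace (𝓡 m)) p (X p))

/-- The extension of a tangent vector at `p` to a vector field that is smooth near `p`
(with constant components in the preferred chart at `p`). -/
def ext {p : M} (v : TangentSpace (𝓡 m) p) : VField m M :=
  FiberBundle.extend (EuclideanSpace ℝ (Fin m)) (E := TangentSpace (𝓡 m)) v

/-- The Lie bracket `[X, Y]` of vector fields. -/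
def bracket (X Y : VField m M) : VField m M :=
  VectorField.mlieBracket (𝓡 m) X Y

/-- The derivative `v f` of a function `f` at `p` along a tangent vector `v`. -/
def dirDeriv (f : M → ℝ) (p : M) (v : TangentSpace (𝓡 m) p) : ℝ :=
  mvfderiv (𝓡 m) f p v

/-- The function `g(X, Y)`. -/
def pair (g : Bilin m M) (X Y : VField m M) : M → ℝ :=
  fun p => g p (X p) (Y p)

/-- The right-hand side of the Koszul formula, which is `2 g(∇_X Y, Z)` at `p` for the
Levi-Civita connection `∇` of `g`. -/
def koszul (g : Bilin m M) (X Y Z : VField m M) (p : M) : ℝ :=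
  dirDeriv (pair g Y Z) p (X p) + dirDeriv (pair g X Z) p (Y p) - dirDeriv (pair g X Y) p (Z p)
    + g p (bracket X Y p) (Z p) - g p (bracket X Z p) (Y p) - g p (bracket Y Z p) (X p)

/-- The Levi-Civita connection of `g`: the vector field `∇_X Y`, whose value at `p` is the vector
`w` (unique, as `g` is nondegenerate) with `2 g(w, z) = koszul g X Y Z` for every tangent
vector `z` at `p`, extended to a vector field `Z`. -/
def leviCivita (g : Bilin m M) (X Y : VField m M) : VField m M :=
  fun p => Classical.epsilon fun w : TangentSpace (𝓡 m) p =>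
    ∀ z : TangentSpace (𝓡 m) p, 2 * g p w z = koszul g X Y (ext z) p

/-- `R(X, Y)Z = ∇_X ∇_Y Z - ∇_Y ∇_X Z - ∇_{[X, Y]} Z`. -/
def curvField (g : Bilin m M) (X Y Z : VField m M) : VField m M :=
  leviCivita g X (leviCivita g Y Z) - leviCivita g Y (leviCivita g X Z)
    - leviCivita g (bracket X Y) Z

/-- The curvature tensor `R(x, y)z` at `p`. -/
def curv (g : Bilin m M) (p : M) (x y z : TangentSpace (𝓡 m) p) : TangentSpace (𝓡 m) p :=
  curvField g (ext x) (ext y) (ext z) p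

/-- The standard basis of the tangent space at `p` in the preferred chart at `p`. -/
def stdBasis (p : M) : Module.Basis (Fin m) ℝ (TangentSpace (𝓡 m) p) :=
  (EuclideanSpace.basisFun (Fin m) ℝ).toBasis

/-- The trace `g^{ij} B(e_i, e_j)` of a bilinear form `B` on the tangent space at `p` with respect
to `g`. -/
def metricTrace (g : Bilin m M) (p : M)
    (B : TangentSpace (𝓡 m) p → TangentSpace (𝓡 m) p → ℝ) : ℝ :=
  ∑ i, ∑ j, (Matrix.of fun i j => g p (stdBasis p i) (stdBasis p j))⁻¹ i j
    * B (stdBasis p i) (stdBasis p j)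

/-- The Ricci tensor of `g`: `ρ(y, z)` is the trace of `x ↦ R(x, y)z`. -/
def ricci (g : Bilin m M) (p : M) (y z : TangentSpace (𝓡 m) p) : ℝ :=
  ∑ i, (stdBasis p).repr (curv g p (stdBasis p i) y z) i

/-- The scalar curvature of `g`: the trace of its Ricci tensor with respect to `g`. -/
def scalarCurv (g : Bilin m M) (p : M) : ℝ :=
  metricTrace g p (ricci g p)

/-- The Lie derivative
`(ℒ_θ g)(x, y) = θ(g(X, Y)) - g([θ, X], Y) - g(X, [θ, Y])` at `p`. -/
def lieDeriv (θ : VField m M) (g : Bilin m M) (p : M) (x y : TangentSpace (𝓡 m) p) : ℝ :=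
  dirDeriv (pair g (ext x) (ext y)) p (θ p)
    - g p (bracket θ (ext x) p) y - g p x (bracket θ (ext y) p)

/-- The equation `ℒ_θ g = 2 ψ g` at the point `p`. -/
def IsConformalAt (θ : VField m M) (g : Bilin m M) (ψ : M → ℝ) (p : M) : Prop :=
  ∀ x y : TangentSpace (𝓡 m) p, lieDeriv θ g p x y = 2 * ψ p * g p x y

/-- `θ` is a conformal vector field with respect to `g`, with potential function `ψ`. -/
def IsConformal (θ : VField m M) (g : Bilin m M) (ψ : M → ℝ) : Prop :=
  ∀ p, IsConformalAt θ g ψ p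

end Metric

/-! ### Almost contact complex Riemannian manifolds -/

/-- An almost contact complex Riemannian (accR) structure `(φ, ξ, η, g)`, also known as an almost
contact B-metric structure, on a `(2n+1)`-dimensional manifold. -/
structure AccRStructure (n : ℕ) (M : Type*) [TopologicalSpace M]
    [ChartedSpace (EuclideanSpace ℝ (Fin (2 * n + 1))) M]
    [IsManifold (𝓡 (2 * n + 1)) ∞ M] where
  /-- the endomorphism of the tangent bundle -/
  φ : ∀ p : M, TangentSpace (𝓡 (2 * n + 1)) p →L[ℝ] TangentSpace (𝓡 (2 * n + 1)) p
  /-- the Reeb vector field -/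
  ξ : VField (2 * n + 1) M
  /-- the contact 1-form -/
  η : ∀ p : M, TangentSpace (𝓡 (2 * n + 1)) p →L[ℝ] ℝ
  /-- the B-metric -/
  g : Bilin (2 * n + 1) M
  smooth_φ : ContMDiff (𝓡 (2 * n + 1))
    ((𝓡 (2 * n + 1)).prod 𝓘(ℝ, EuclideanSpace ℝ (Fin (2 * n + 1)) →L[ℝ]
      EuclideanSpace ℝ (Fin (2 * n + 1)))) ∞
    (fun p => TotalSpace.mk' (EuclideanSpace ℝ (Fin (2 * n + 1)) →L[ℝ]
      EuclideanSpace ℝ (Fin (2 * n + 1)))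
      (E := fun p : M => TangentSpace (𝓡 (2 * n + 1)) p →L[ℝ] TangentSpace (𝓡 (2 * n + 1)) p)
      p (φ p))
  smooth_ξ : SmoothVField ξ
  smooth_η : ContMDiff (𝓡 (2 * n + 1))
    ((𝓡 (2 * n + 1)).prod 𝓘(ℝ, EuclideanSpace ℝ (Fin (2 * n + 1)) →L[ℝ] ℝ)) ∞
    (fun p => TotalSpace.mk' (EuclideanSpace ℝ (Fin (2 * n + 1)) →L[ℝ] ℝ)
      (E := fun p : M => TangentSpace (𝓡 (2 * n + 1)) p →L[ℝ] ℝ) p (η p))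
  smooth_g : ContMDiff (𝓡 (2 * n + 1))
    ((𝓡 (2 * n + 1)).prod 𝓘(ℝ, EuclideanSpace ℝ (Fin (2 * n + 1)) →L[ℝ]
      EuclideanSpace ℝ (Fin (2 * n + 1)) →L[ℝ] ℝ)) ∞
    (fun p => TotalSpace.mk' (EuclideanSpace ℝ (Fin (2 * n + 1)) →L[ℝ]
      EuclideanSpace ℝ (Fin (2 * n + 1)) →L[ℝ] ℝ)
      (E := fun p : M => TangentSpace (𝓡 (2 * n + 1)) p →L[ℝ]
        TangentSpace (𝓡 (2 * n + 1)) p →L[ℝ] ℝ) p (g p))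
  g_symm : ∀ p x y, g p x y = g p y x
  /-- `g` is a pseudo-Riemannian metric of signature `(n + 1, n)` -/
  g_signature : ∀ p : M,
    ∃ b : Module.Basis (Fin (n + 1) ⊕ Fin n) ℝ (TangentSpace (𝓡 (2 * n + 1)) p),
      (∀ i j, i ≠ j → g p (b i) (b j) = 0) ∧
      (∀ i, g p (b (Sum.inl i)) (b (Sum.inl i)) = 1) ∧
      (∀ i, g p (b (Sum.inr i)) (b (Sum.inr i)) = -1)
  φ_ξ : ∀ p, φ p (ξ p) = 0
  φ_φ : ∀ p x, φ p (φ p x) = -x + η p x • ξ p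
  η_φ : ∀ p x, η p (φ p x) = 0
  η_ξ : ∀ p, η p (ξ p) = 1
  g_φ_φ : ∀ p x y, g p (φ p x) (φ p y) = -g p x y + η p x * η p y

namespace AccRStructure

variable {n : ℕ} {M : Type*} [TopologicalSpace M]
  [ChartedSpace (EuclideanSpace ℝ (Fin (2 * n + 1))) M] [IsManifold (𝓡 (2 * n + 1)) ∞ M]
  (S : AccRStructure n M)

/-- The associated B-metric `g̃(x, y) = g(x, φ y) + η(x) η(y)`. -/
def gTilde : Bilin (2 * n + 1) M :=
  fun p => ((S.φ p).precomp ℝ).comp (S.g p) + (S.η p).smulRight (S.η p)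

theorem gTilde_apply (p : M) (x y : TangentSpace (𝓡 (2 * n + 1)) p) :
    S.gTilde p x y = S.g p x (S.φ p y) + S.η p x * S.η p y := by
  simp [gTilde]

/-- The tensor `F(x, y, z) = g((∇_x φ) y, z)`, where `(∇_x φ) y = ∇_x (φ y) - φ (∇_x y)` and `∇` is
the Levi-Civita connection of `g`. -/
def F (p : M) (x y z : TangentSpace (𝓡 (2 * n + 1)) p) : ℝ :=
  S.g p (leviCivita S.g (ext x) (fun q => S.φ q (ext y q)) p
    - S.φ p (leviCivita S.g (ext x) (ext y) p)) z

/-- The manifold is Sasaki-like: `F(x, y, z) = g(φ x, φ y) η(z) + g(φ x, φ z) η(y)`. -/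
def IsSasakiLike : Prop :=
  ∀ (p : M) (x y z : TangentSpace (𝓡 (2 * n + 1)) p),
    S.F p x y z = S.g p (S.φ p x) (S.φ p y) * S.η p z + S.g p (S.φ p x) (S.φ p z) * S.η p y

/-- The Ricci tensor `ρ` of `g`. -/
def rho (p : M) (x y : TangentSpace (𝓡 (2 * n + 1)) p) : ℝ := ricci S.g p x y

/-- The scalar curvature `τ` of `g`. -/
def tau (p : M) : ℝ := scalarCurv S.g p

/-- The scalar curvature `τ̃` of `g̃`, with respect to the Levi-Civita connection of `g̃`. -/
def tauTilde (p : M) : ℝ := scalarCurv S.gTilde p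

/-- The manifold is Einstein-like: `ρ = a g + b g̃ + c η ⊗ η` for constants `a`, `b`, `c`. -/
def IsEinsteinLike : Prop :=
  ∃ a b c : ℝ, ∀ (p : M) (x y : TangentSpace (𝓡 (2 * n + 1)) p),
    S.rho p x y = a * S.g p x y + b * S.gTilde p x y + c * (S.η p x * S.η p y)

/-- The equation
`ρ + ½ ℒ_θ g + ½ ℒ_θ g̃ + (lam + β τ) g + (lam' + β τ̃) g̃ = 0` at the point `p`. -/
def SolitonEqAt (β : ℝ) (θ : VField (2 * n + 1) M) (lam lam' : M → ℝ) (p : M) : Prop :=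
  ∀ x y : TangentSpace (𝓡 (2 * n + 1)) p,
    S.rho p x y + 1 / 2 * lieDeriv θ S.g p x y + 1 / 2 * lieDeriv θ S.gTilde p x y
      + (lam p + β * S.tau p) * S.g p x y
      + (lam' p + β * S.tauTilde p) * S.gTilde p x y = 0

/-- The manifold is a `β`-Ricci-Bourguignon-like almost soliton with potential vector field `θ` and
soliton functions `lam`, `lam'`. -/
def IsRBLikeAlmostSoliton (β : ℝ) (θ : VField (2 * n + 1) M) (lam lam' : M → ℝ) : Prop :=
  ∀ p, S.SolitonEqAt β θ lam lam' p

/-- The identity `ρ = (τ / 2n - 1) g + (τ̃ / 2n - 1) g̃` at the point `p`. -/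
def RicciFormulaAt (p : M) : Prop :=
  ∀ x y : TangentSpace (𝓡 (2 * n + 1)) p,
    S.rho p x y = (S.tau p / (2 * n) - 1) * S.g p x y
      + (S.tauTilde p / (2 * n) - 1) * S.gTilde p x y

end AccRStructure

end AccR

end

/-! The proof compares both Levi-Civita connections with one torsion-free connection, D = ∇ + η⊗φ +
φ⊗η − g(φ·,·)ξ (`adaptedConnection`). On a Sasaki-like manifold φ, ξ and η are D-parallel
(`IsAlmostContactB.isParallelStructure`), and D only rotates the metric: (D_w g)(x,y) = −2η(w)
g(φx,y).

Both Levi-Civita connections have the form D − η⊗φ − φ⊗η + kξ, with k = g(φ·,·) for g and k =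
g(φ²·,·) for g̃. The form k drops out of the Ricci tensor, which is Ric(D) + 2n η⊗η in both cases
(`IsParallelStructure.ricciForm_eq`). Hence g and g̃ have the same Ricci tensor ρ, and ρ(ξ,ξ) = 2n
because the curvature of D annihilates ξ.

At a point where the soliton and conformality equations hold, ρ = A g + B g̃ with A = −(ψ+λ+βτ) and
B = −(ψ̃+λ̃+βτ̃). Evaluation at (ξ,ξ) gives A + B = 2n. Since tr φ = 0, the traces are τ = (2n+1)A +
B and τ̃ = A + (2n+1)B (`tau_eq`, `tauTilde_eq`). All the formulas are linear algebra from these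
three relations.

Only the constancy of the Einstein-like coefficients needs the equations on an open set. The Bianchi
identities give R^D(ξ,·) = 0 and D_ξ Ric(D) = 0, whereas g and g(φ·,·) rotate into each other along
ξ. Together with A + B = 2n this forces B = n, hence A = n
(`IsAlmostContactB.ricci_coefficient_eq`).

The tensor calculus takes place on an open subset of a normed space; charts transfer it to the
manifold. -/

noncomputable section

namespace AccR

/-! ### Connections on open subsets of a normed space -/

/-! ### Shortcut instances for iterated spaces of continuous linear maps -/

section Instances

variable {E : Type*} [NormedAddCommGroup E] [NormedSpace ℝ E]
  {F : Type*} [NormedAddCommGroup F] [NormedSpace ℝ F]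

instance normedAddCommGroupHom₁ : NormedAddCommGroup (E →L[ℝ] F) :=
  ContinuousLinearMap.toNormedAddCommGroup

instance normedSpaceHom₁ : NormedSpace ℝ (E →L[ℝ] F) :=
  ContinuousLinearMap.toNormedSpace

instance normedAddCommGroupHom₂ : NormedAddCommGroup (E →L[ℝ] E →L[ℝ] F) :=
  ContinuousLinearMap.toNormedAddCommGroup

instance normedSpaceHom₂ : NormedSpace ℝ (E →L[ℝ] E →L[ℝ] F) :=
  ContinuousLinearMap.toNormedSpace

instance addZeroClassHom₁ : AddZeroClass (E →L[ℝ] F) := inferInstance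

instance addZeroClassHom₂ : AddZeroClass (E →L[ℝ] E →L[ℝ] F) := inferInstance

end Instances

/-! ### Calculus along straight lines. -/

section Line

variable {E F : Type*} [NormedAddCommGroup E] [NormedSpace ℝ E]
  [NormedAddCommGroup F] [NormedSpace ℝ F]

/-- Tensor identities valid on an open set are differentiated by restricting them to lines t ↦ u + t
w. The product rules for `HasDerivAt` then replace covariant tensor calculus. -/
theorem hasDerivAt_line {f : E → F} {u : E} (hf : DifferentiableAt ℝ f u) (w : E) :
    HasDerivAt (fun t : ℝ => f (u + t • w)) (fderiv ℝ f u w) 0 := by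
  have h1 : HasDerivAt (fun t : ℝ => u + t • w) w 0 := by
    simpa using ((hasDerivAt_id (0 : ℝ)).smul_const w).const_add u
  have h2 : HasFDerivAt f (fderiv ℝ f u) (u + (0 : ℝ) • w) := by simpa using hf.hasFDerivAt
  exact h2.comp_hasDerivAt (0 : ℝ) h1

theorem eventually_line_mem {U : Set E} (hU : IsOpen U) {u : E} (hu : u ∈ U) (w : E) :
    ∀ᶠ t : ℝ in nhds 0, u + t • w ∈ U := by
  have h1 : ContinuousAt (fun t : ℝ => u + t • w) 0 := by fun_prop
  exact h1 (by simpa using hU.mem_nhds hu)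

/-- Two curves that agree on the part of the line `u + t w` in `U` have the same derivative. -/
theorem deriv_line_eq {U : Set E} (hU : IsOpen U) {u : E} (hu : u ∈ U) {w : E}
    {f g : ℝ → F} {a b : F} (hf : HasDerivAt f a 0) (hg : HasDerivAt g b 0)
    (h : ∀ t : ℝ, u + t • w ∈ U → f t = g t) : a = b :=
  hf.unique (hg.congr_of_eventuallyEq ((eventually_line_mem hU hu w).mono h))

theorem fderiv_fderiv_symm {f : E → F} {u : E} (hf : ContDiffAt ℝ ∞ f u) (v w : E) :
    fderiv ℝ (fderiv ℝ f) u v w = fderiv ℝ (fderiv ℝ f) u w v :=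
  (hf.isSymmSndFDerivAt (by simpa using ENat.LEInfty.out)).eq v w

theorem differentiableAt_of_contDiffOn {U : Set E} (hU : IsOpen U) {u : E} (hu : u ∈ U)
    {f : E → F} (hf : ContDiffOn ℝ ∞ f U) : DifferentiableAt ℝ f u :=
  (hf.contDiffAt (hU.mem_nhds hu)).differentiableAt (by simp)

theorem contDiffOn_fderiv {U : Set E} (hU : IsOpen U) {f : E → F} (hf : ContDiffOn ℝ ∞ f U) :
    ContDiffOn ℝ ∞ (fderiv ℝ f) U :=
  hf.fderiv_of_isOpen hU (by simp)

end Line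

/-! ### Curvature and Ricci tensor of a connection given by Christoffel symbols. -/

section Connection

variable {E : Type*} [NormedAddCommGroup E] [NormedSpace ℝ E]

/-- The derivative `∇_X Y` for the connection with Christoffel symbols `Γ`. -/
def covD (Γ : E → E →L[ℝ] E →L[ℝ] E) (X Y : E → E) (u : E) : E :=
  fderiv ℝ Y u (X u) + Γ u (X u) (Y u)

/-- The curvature operator `R(x, y)` of the connection with Christoffel symbols `Γ`. -/
def curvOp (Γ : E → E →L[ℝ] E →L[ℝ] E) (u x y : E) : E →L[ℝ] E :=
  fderiv ℝ Γ u x y - fderiv ℝ Γ u y x + Γ u x ∘L Γ u y - Γ u y ∘L Γ u x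

theorem curvOp_apply (Γ : E → E →L[ℝ] E →L[ℝ] E) (u x y z : E) :
    curvOp Γ u x y z = fderiv ℝ Γ u x y z - fderiv ℝ Γ u y x z + Γ u x (Γ u y z)
      - Γ u y (Γ u x z) := rfl

theorem curvOp_swap (Γ : E → E →L[ℝ] E →L[ℝ] E) (u x y : E) :
    curvOp Γ u x y = -curvOp Γ u y x := by
  ext z; simp [curvOp_apply]; abel

theorem curvOp_add_left (Γ : E → E →L[ℝ] E →L[ℝ] E) (u x x' y : E) :
    curvOp Γ u (x + x') y = curvOp Γ u x y + curvOp Γ u x' y := by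
  ext z
  simp only [curvOp_apply, (fderiv ℝ Γ u).map_add, (fderiv ℝ Γ u y).map_add, (Γ u).map_add,
    (Γ u y).map_add, add_apply]
  abel

theorem curvOp_smul_left (Γ : E → E →L[ℝ] E →L[ℝ] E) (u : E) (c : ℝ) (x y : E) :
    curvOp Γ u (c • x) y = c • curvOp Γ u x y := by
  ext z
  simp only [curvOp_apply, (fderiv ℝ Γ u).map_smul, (fderiv ℝ Γ u y).map_smul, (Γ u).map_smul,
    (Γ u y).map_smul, smul_apply, smul_sub, smul_add]

theorem curvOp_neg_left (Γ : E → E →L[ℝ] E →L[ℝ] E) (u x y : E) :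
    curvOp Γ u (-x) y = -curvOp Γ u x y := by
  simpa using curvOp_smul_left Γ u (-1) x y

/-- The map `x ↦ R(x, y)z`. -/
def curvMap (Γ : E → E →L[ℝ] E →L[ℝ] E) (u y z : E) : E →ₗ[ℝ] E where
  toFun x := curvOp Γ u x y z
  map_add' x x' := by simp [curvOp_add_left]
  map_smul' c x := by simp [curvOp_smul_left]

theorem curvMap_apply (Γ : E → E →L[ℝ] E →L[ℝ] E) (u x y z : E) :
    curvMap Γ u y z x = curvOp Γ u x y z := rfl

/-- The Ricci tensor of the connection with Christoffel symbols `Γ`. -/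
def ricciForm (Γ : E → E →L[ℝ] E →L[ℝ] E) (u y z : E) : ℝ :=
  LinearMap.trace ℝ E (curvMap Γ u y z)

/-- The curvature formula `R(X, Y)Z = ∇_X ∇_Y Z - ∇_Y ∇_X Z - ∇_{[X, Y]} Z`. -/
theorem covD_covD_sub {Γ : E → E →L[ℝ] E →L[ℝ] E} {X Y Z : E → E} {u : E}
    (hΓ : DifferentiableAt ℝ Γ u) (hX : DifferentiableAt ℝ X u) (hY : DifferentiableAt ℝ Y u)
    (hZ : ContDiffAt ℝ ∞ Z u) :
    covD Γ X (covD Γ Y Z) u - covD Γ Y (covD Γ X Z) u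
      - covD Γ (VectorField.lieBracket ℝ X Y) Z u = curvOp Γ u (X u) (Y u) (Z u) := by
  have hZ1 : DifferentiableAt ℝ Z u := hZ.differentiableAt (by simp)
  have hZ2 : DifferentiableAt ℝ (fderiv ℝ Z) u :=
    (hZ.fderiv_right (m := 1) (by norm_cast)).differentiableAt (by simp)
  -- After antisymmetrisation the second derivative of `Z` cancels by symmetry, and the derivatives
  -- of `X` and `Y` are absorbed by the bracket term.
  have key : ∀ {X Y : E → E}, DifferentiableAt ℝ X u → DifferentiableAt ℝ Y u →
      covD Γ X (covD Γ Y Z) u = fderiv ℝ (fderiv ℝ Z) u (X u) (Y u)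
        + fderiv ℝ Z u (fderiv ℝ Y u (X u)) + (fderiv ℝ Γ u (X u) (Y u) (Z u)
        + Γ u (fderiv ℝ Y u (X u)) (Z u)
        + Γ u (Y u) (fderiv ℝ Z u (X u))) + Γ u (X u) (fderiv ℝ Z u (Y u) + Γ u (Y u) (Z u)) := by
    intro X Y hX hY
    have h1 : HasFDerivAt (covD Γ Y Z) _ u :=
      (hZ2.hasFDerivAt.clm_apply hY.hasFDerivAt).add
        ((hΓ.hasFDerivAt.clm_apply hY.hasFDerivAt).clm_apply hZ1.hasFDerivAt)
    rw [covD, h1.fderiv]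
    simp [covD]
    abel
  rw [key hX hY, key hY hX]
  simp only [covD, VectorField.lieBracket_eq, map_sub, sub_apply, map_add,
    curvOp_apply, fderiv_fderiv_symm hZ (X u) (Y u)]
  abel

end Connection

/-! ### Connections adapted to an almost contact structure -/

section Adapted

variable {E : Type*} [NormedAddCommGroup E] [NormedSpace ℝ E]

/-- An almost contact structure on an open set, with a torsion-free connection for which the
structure tensors are parallel. -/
structure IsParallelStructure (U : Set E) (φ : E → E →L[ℝ] E) (ξ : E → E) (η : E → E →L[ℝ] ℝ)
    (Γ : E → E →L[ℝ] E →L[ℝ] E) : Prop where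
  isOpen : IsOpen U
  smooth_φ : ContDiffOn ℝ ∞ φ U
  smooth_ξ : ContDiffOn ℝ ∞ ξ U
  smooth_η : ContDiffOn ℝ ∞ η U
  smooth_Γ : ContDiffOn ℝ ∞ Γ U
  φ_ξ : ∀ u ∈ U, φ u (ξ u) = 0
  φ_φ : ∀ u ∈ U, ∀ x, φ u (φ u x) = -x + η u x • ξ u
  η_φ : ∀ u ∈ U, ∀ x, η u (φ u x) = 0
  η_ξ : ∀ u ∈ U, η u (ξ u) = 1
  Γ_symm : ∀ u ∈ U, ∀ x y, Γ u x y = Γ u y x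
  fderiv_φ : ∀ u ∈ U, ∀ w x, fderiv ℝ φ u w x = φ u (Γ u w x) - Γ u w (φ u x)
  fderiv_ξ : ∀ u ∈ U, ∀ w, fderiv ℝ ξ u w = -Γ u w (ξ u)
  fderiv_η : ∀ u ∈ U, ∀ w x, fderiv ℝ η u w x = η u (Γ u w x)

/-- A smooth symmetric bilinear form `k` that is symmetric for `φ` with
`(∇_x k)(y, z) = -2 η(x) k(φ y, z)`. -/
structure IsRotatingForm (U : Set E) (φ : E → E →L[ℝ] E) (η : E → E →L[ℝ] ℝ)
    (Γ : E → E →L[ℝ] E →L[ℝ] E) (k : E → E →L[ℝ] E →L[ℝ] ℝ) : Prop where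
  smooth : ContDiffOn ℝ ∞ k U
  symm : ∀ u ∈ U, ∀ x y, k u x y = k u y x
  φ_symm : ∀ u ∈ U, ∀ x y, k u (φ u x) y = k u x (φ u y)
  fderiv_form : ∀ u ∈ U, ∀ w x y, fderiv ℝ k u w x y = k u (Γ u w x) y + k u x (Γ u w y)
    - 2 * η u w * k u (φ u x) y

variable {U : Set E} {φ : E → E →L[ℝ] E} {ξ : E → E} {η : E → E →L[ℝ] ℝ}
  {Γ Γ' : E → E →L[ℝ] E →L[ℝ] E} {k g : E → E →L[ℝ] E →L[ℝ] ℝ}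

/-- The curvature of `∇ + T`, where `T(x, y) = -η(x) φ y - η(y) φ x + k(x, y) ξ`. -/
theorem IsParallelStructure.curvOp_eq (h : IsParallelStructure U φ ξ η Γ)
    (hk : IsRotatingForm U φ η Γ k) (hkξ : ∀ u ∈ U, ∀ x, k u x (ξ u) = 0)
    (hΓ' : ContDiffOn ℝ ∞ Γ' U)
    (hT : ∀ u ∈ U, ∀ x y, Γ' u x y = Γ u x y - η u x • φ u y - η u y • φ u x + k u x y • ξ u)
    {u : E} (hu : u ∈ U) (x y z : E) :
    curvOp Γ' u x y z = curvOp Γ u x y z + η u z • (η u y • x - η u x • y)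
      - k u y z • φ u x + k u x z • φ u y
      + (η u y * k u x (φ u z) - η u x * k u y (φ u z)) • ξ u := by
  have dφ := fun w => hasDerivAt_line (differentiableAt_of_contDiffOn h.isOpen hu h.smooth_φ) w
  have dξ := fun w => hasDerivAt_line (differentiableAt_of_contDiffOn h.isOpen hu h.smooth_ξ) w
  have dη := fun w => hasDerivAt_line (differentiableAt_of_contDiffOn h.isOpen hu h.smooth_η) w
  have dΓ := fun w => hasDerivAt_line (differentiableAt_of_contDiffOn h.isOpen hu h.smooth_Γ) w
  have dΓ' := fun w => hasDerivAt_line (differentiableAt_of_contDiffOn h.isOpen hu hΓ') w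
  have dk := fun w => hasDerivAt_line (differentiableAt_of_contDiffOn h.isOpen hu hk.smooth) w
  have c := fun a : E => hasDerivAt_const (0 : ℝ) a
  -- The formula `hT` is differentiated along `w`. The structure equations express every derivative
  -- of φ, ξ, η and k through Γ, so the Γ-terms cancel in the curvature and only terms algebraic in
  -- T remain.
  have key : ∀ w x y, fderiv ℝ Γ' u w x y = fderiv ℝ Γ u w x y
      - (η u x • (φ u (Γ u w y) - Γ u w (φ u y)) + η u (Γ u w x) • φ u y)
      - (η u y • (φ u (Γ u w x) - Γ u w (φ u x)) + η u (Γ u w y) • φ u x)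
      + (-(k u x y • Γ u w (ξ u)) + (k u (Γ u w x) y + k u x (Γ u w y)
        - 2 * η u w * k u (φ u x) y) • ξ u) := by
    intro w x y
    have e := deriv_line_eq h.isOpen hu (((dΓ' w).clm_apply (c x)).clm_apply (c y))
      (((((dΓ w).clm_apply (c x)).clm_apply (c y)).sub
        (((dη w).clm_apply (c x)).smul ((dφ w).clm_apply (c y)))).sub
        (((dη w).clm_apply (c y)).smul ((dφ w).clm_apply (c x))) |>.add
        ((((dk w).clm_apply (c x)).clm_apply (c y)).smul (dξ w)))
      (fun t ht => hT _ ht x y)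
    simpa [h.fderiv_φ u hu, h.fderiv_ξ u hu, h.fderiv_η u hu, hk.fderiv_form u hu] using e
  have s1 := hk.symm u hu x (φ u y)
  have s2 := hk.φ_symm u hu
  have e1 : Γ u y x = Γ u x y := h.Γ_symm u hu y x
  rw [curvOp_apply, curvOp_apply, key, key]
  simp only [hT u hu, map_add, map_sub, map_smul, h.φ_ξ u hu, h.φ_φ u hu,
    h.η_φ u hu, h.η_ξ u hu, hkξ u hu, s2, smul_eq_mul, mul_zero, mul_one,
    h.Γ_symm u hu _ (ξ u), e1]
  rw [s1, s2]
  module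

end Adapted

end AccR

namespace AccR

/-! ### Traces -/

section Trace

variable {E : Type*} [AddCommGroup E] [Module ℝ E] [FiniteDimensional ℝ E]

/-- A real endomorphism `f` with `f³ = -f` is traceless. -/
theorem trace_eq_zero_of_cube_eq_neg (f : E →ₗ[ℝ] E) (hf : ∀ x, f (f (f x)) = -f x) :
    LinearMap.trace ℝ E f = 0 := by
  -- Over ℂ the eigenvalues satisfy r(r² + 1) = 0, so they are purely imaginary or zero. The trace
  -- is their sum and also a real number, hence zero.
  set F : Module.End ℂ (TensorProduct ℝ ℂ E) := f.baseChange ℂ with hF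
  have h1 : F * F * F = -F := by
    have h2 : f * f * f = -f := LinearMap.ext fun x => by simpa using hf x
    rw [hF, ← LinearMap.baseChange_mul, ← LinearMap.baseChange_mul, h2, LinearMap.baseChange_neg]
  have h3 : (LinearMap.trace ℂ _ F) = ((LinearMap.trace ℝ E f : ℝ) : ℂ) := by
    exact LinearMap.trace_baseChange f ℂ
  rw [Module.End.trace_eq_sum_roots_charpoly_of_splits (IsAlgClosed.splits _)] at h3
  have h4 : ∀ r ∈ F.charpoly.roots, r.re = 0 := by
    intro r hr
    have h5 : Module.End.HasEigenvalue F r :=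
      (Module.End.hasEigenvalue_iff_isRoot_charpoly F r).2 (Polynomial.isRoot_of_mem_roots hr)
    obtain ⟨v, hv⟩ := h5.exists_hasEigenvector
    have h6 := LinearMap.congr_fun h1 v
    have h7 : r * (r * r + 1) = 0 := by
      have h8 : (r * (r * r + 1)) • v = 0 := by
        simp only [Module.End.mul_apply, hv.apply_eq_smul, map_smul, LinearMap.neg_apply] at h6
        linear_combination (norm := module) h6
      exact (smul_eq_zero.1 h8).resolve_right hv.2
    rcases mul_eq_zero.1 h7 with h | h
    · simp [h]
    · have h8 := congrArg Complex.re h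
      have h9 := congrArg Complex.im h
      simp at h8 h9
      by_contra hre
      have : r.im = 0 := by
        have : r.re * r.im = 0 := by linarith
        exact (mul_eq_zero.1 this).resolve_left hre
      rw [this] at h8
      nlinarith [sq_nonneg r.re]
  have h5 : (F.charpoly.roots.sum).re = 0 := by
    rw [← Complex.reLm_coe, map_multiset_sum]
    exact Multiset.sum_eq_zero fun x hx => by
      obtain ⟨r, hr, rfl⟩ := Multiset.mem_map.1 hx
      exact h4 r hr
  rw [h3] at h5
  simpa using h5

end Trace

/-! ### Ricci and Bianchi identities for the adapted connection. -/

section Adapted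

variable {E : Type*} [NormedAddCommGroup E] [NormedSpace ℝ E]
  {U : Set E} {φ : E → E →L[ℝ] E} {ξ : E → E} {η : E → E →L[ℝ] ℝ}
  {Γ Γ' : E → E →L[ℝ] E →L[ℝ] E} {k g : E → E →L[ℝ] E →L[ℝ] ℝ}

namespace IsParallelStructure

/-- The Ricci tensor of `∇ + T`, where `T(x, y) = -η(x) φ y - η(y) φ x + k(x, y) ξ`. -/
theorem ricciForm_eq [FiniteDimensional ℝ E] (h : IsParallelStructure U φ ξ η Γ)
    (hk : IsRotatingForm U φ η Γ k) (hkξ : ∀ u ∈ U, ∀ x, k u x (ξ u) = 0)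
    (hΓ' : ContDiffOn ℝ ∞ Γ' U)
    (hT : ∀ u ∈ U, ∀ x y, Γ' u x y = Γ u x y - η u x • φ u y - η u y • φ u x + k u x y • ξ u)
    {n : ℕ} (hn : Module.finrank ℝ E = 2 * n + 1) {u : E} (hu : u ∈ U) (y z : E) :
    ricciForm Γ' u y z = ricciForm Γ u y z + 2 * n * (η u y * η u z) := by
  -- The correction is a combination of the identity, φ and rank-one maps. The identity and η⊗y
  -- contribute (2n+1) − 1 = 2n copies of η(y)η(z).
  have h1 : curvMap Γ' u y z = curvMap Γ u y z
      + η u z • (η u y • LinearMap.id - (η u : E →ₗ[ℝ] ℝ).smulRight y)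
      - k u y z • (φ u : E →ₗ[ℝ] E) + ((k u).flip z : E →ₗ[ℝ] ℝ).smulRight (φ u y)
      + (η u y • ((k u).flip (φ u z) : E →ₗ[ℝ] ℝ)
        - k u y (φ u z) • (η u : E →ₗ[ℝ] ℝ)).smulRight (ξ u) := by
    ext x
    simp [curvMap_apply, h.curvOp_eq hk hkξ hΓ' hT hu, mul_comm (η u x)]
  have h2 : LinearMap.trace ℝ E (φ u : E →ₗ[ℝ] E) = 0 := by
    refine trace_eq_zero_of_cube_eq_neg _ fun x => ?_
    simp [h.φ_φ u hu, h.φ_ξ u hu]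
  have h3 : k u (ξ u) (φ u z) = 0 := by rw [hk.symm u hu, hkξ u hu]
  -- The traces k(φy,z) and −k(y,φz) cancel. This is why the result does not depend on k.
  have h4 := hk.φ_symm u hu y z
  rw [ricciForm, ricciForm, h1]
  simp only [map_add, map_sub, map_smul, LinearMap.trace_smulRight, LinearMap.trace_id, h2, hn,
    LinearMap.sub_apply, LinearMap.smul_apply, ContinuousLinearMap.coe_coe,
    ContinuousLinearMap.flip_apply, h3, h4, h.η_ξ u hu, smul_eq_mul]
  push_cast
  ring

/-- The curvature annihilates the Reeb field. -/
theorem curvOp_apply_ξ (h : IsParallelStructure U φ ξ η Γ) {u : E} (hu : u ∈ U) (x y : E) :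
    curvOp Γ u x y (ξ u) = 0 := by
  have dξ := fun w => hasDerivAt_line (differentiableAt_of_contDiffOn h.isOpen hu h.smooth_ξ) w
  have dξ' := fun w => hasDerivAt_line (differentiableAt_of_contDiffOn h.isOpen hu
    (contDiffOn_fderiv h.isOpen h.smooth_ξ)) w
  have dΓ := fun w => hasDerivAt_line (differentiableAt_of_contDiffOn h.isOpen hu h.smooth_Γ) w
  have c := fun a : E => hasDerivAt_const (0 : ℝ) a
  -- The equation Dξ = 0 is differentiated once more; symmetry of the second derivative of ξ is then
  -- the Ricci identity R(x,y)ξ = 0.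
  have key : ∀ v w, fderiv ℝ (fderiv ℝ ξ) u v w
      = -(fderiv ℝ Γ u v w (ξ u) - Γ u w (Γ u v (ξ u))) := by
    intro v w
    have e := deriv_line_eq h.isOpen hu ((dξ' v).clm_apply (c w))
      (((dΓ v).clm_apply (c w)).clm_apply (dξ v)).neg (fun t ht => h.fderiv_ξ _ ht w)
    simpa [h.fderiv_ξ u hu, sub_eq_add_neg] using e
  have e := fderiv_fderiv_symm (h.smooth_ξ.contDiffAt (h.isOpen.mem_nhds hu)) x y
  rw [key, key] at e
  rw [curvOp_apply]
  linear_combination (norm := module) -e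

theorem fderiv_Γ_symm (h : IsParallelStructure U φ ξ η Γ) {u : E} (hu : u ∈ U) (w x y : E) :
    fderiv ℝ Γ u w x y = fderiv ℝ Γ u w y x := by
  have dΓ := hasDerivAt_line (differentiableAt_of_contDiffOn h.isOpen hu h.smooth_Γ) w
  have c := fun a : E => hasDerivAt_const (0 : ℝ) a
  have e := deriv_line_eq h.isOpen hu ((dΓ.clm_apply (c x)).clm_apply (c y))
    ((dΓ.clm_apply (c y)).clm_apply (c x)) (fun t ht => h.Γ_symm _ ht x y)
  simpa using e

/-- The first Bianchi identity. -/
theorem bianchi_first (h : IsParallelStructure U φ ξ η Γ) {u : E} (hu : u ∈ U) (x y z : E) :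
    curvOp Γ u x y z + curvOp Γ u y z x + curvOp Γ u z x y = 0 := by
  simp only [curvOp_apply, h.fderiv_Γ_symm hu _ z, h.fderiv_Γ_symm hu _ y x, h.Γ_symm u hu z,
    h.Γ_symm u hu y x]
  abel

/-- The curvature is skew with respect to a rotating form. -/
theorem curvOp_skew (h : IsParallelStructure U φ ξ η Γ) (hg : IsRotatingForm U φ η Γ g)
    {u : E} (hu : u ∈ U) (x y z w : E) :
    g u (curvOp Γ u x y z) w + g u z (curvOp Γ u x y w) = 0 := by
  have dφ := fun w => hasDerivAt_line (differentiableAt_of_contDiffOn h.isOpen hu h.smooth_φ) w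
  have dη := fun w => hasDerivAt_line (differentiableAt_of_contDiffOn h.isOpen hu h.smooth_η) w
  have dΓ := fun w => hasDerivAt_line (differentiableAt_of_contDiffOn h.isOpen hu h.smooth_Γ) w
  have dg := fun w => hasDerivAt_line (differentiableAt_of_contDiffOn h.isOpen hu hg.smooth) w
  have dg' := fun w => hasDerivAt_line (differentiableAt_of_contDiffOn h.isOpen hu
    (contDiffOn_fderiv h.isOpen hg.smooth)) w
  have c := fun a : E => hasDerivAt_const (0 : ℝ) a
  have key : ∀ a b, fderiv ℝ (fderiv ℝ g) u a b z w
      = (fderiv ℝ g u a (Γ u b z) w + g u (fderiv ℝ Γ u a b z) w)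
        + (fderiv ℝ g u a z (Γ u b w) + g u z (fderiv ℝ Γ u a b w))
        - (2 * fderiv ℝ η u a b * g u (φ u z) w
          + 2 * η u b * (fderiv ℝ g u a (φ u z) w + g u (fderiv ℝ φ u a z) w)) := by
    intro a b
    have e := deriv_line_eq h.isOpen hu ((((dg' a).clm_apply (c b)).clm_apply (c z)).clm_apply (c w))
      ((((dg a).clm_apply (((dΓ a).clm_apply (c b)).clm_apply (c z))).clm_apply (c w)).add
        (((dg a).clm_apply (c z)).clm_apply (((dΓ a).clm_apply (c b)).clm_apply (c w))) |>.sub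
        ((((dη a).clm_apply (c b)).const_mul 2).mul
          (((dg a).clm_apply ((dφ a).clm_apply (c z))).clm_apply (c w))))
      (fun t ht => hg.fderiv_form _ ht b z w)
    simpa using e
  -- Ricci identity for g. The antisymmetrised second covariant derivative of g vanishes: dη = 0, as
  -- η is parallel and D torsion-free, φ is parallel, and the term quadratic in η is symmetric.
  have e := fderiv_fderiv_symm (hg.smooth.contDiffAt (h.isOpen.mem_nhds hu)) x y
  have e' := congrArg (fun L => L z w) e
  simp only [key, hg.fderiv_form u hu, h.fderiv_η u hu, h.fderiv_φ u hu, h.Γ_symm u hu y x,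
    map_sub, sub_apply] at e'
  simp only [curvOp_apply, map_sub, map_add, sub_apply, add_apply]
  linarith

/-- The curvature vanishes in the direction of the Reeb field. -/
theorem curvOp_ξ (h : IsParallelStructure U φ ξ η Γ) (hg : IsRotatingForm U φ η Γ g)
    (hnd : ∀ u ∈ U, ∀ x, (∀ y, g u x y = 0) → x = 0) {u : E} (hu : u ∈ U) (x : E) :
    curvOp Γ u (ξ u) x = 0 := by
  ext y
  refine hnd u hu _ fun z => ?_
  -- The first Bianchi identity and R(x,y)ξ = 0 make g(R(ξ,x)y,z) symmetric in x, y, and it is skew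
  -- in y, z. Alternating the two symmetries shows that such a trilinear form equals its own
  -- negative.
  have s : ∀ x y, curvOp Γ u (ξ u) x y = curvOp Γ u (ξ u) y x := by
    intro x y
    have e := h.bianchi_first hu (ξ u) x y
    rw [h.curvOp_apply_ξ hu, curvOp_swap Γ u y] at e
    simp only [neg_apply] at e
    linear_combination (norm := module) e
  have a : ∀ x y z, g u (curvOp Γ u (ξ u) x y) z = -g u (curvOp Γ u (ξ u) x z) y := by
    intro x y z
    have e := h.curvOp_skew hg hu (ξ u) x y z
    rw [hg.symm u hu y] at e
    linarith
  have e1 := a x y z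
  rw [s x z, a z x y, s z y, a y z x, s y x] at e1
  linarith

/-- The derivative of the curvature along a line. -/
theorem hasDerivAt_curvOp (h : IsParallelStructure U φ ξ η Γ) {u : E} (hu : u ∈ U) (w y z : E)
    {X : ℝ → E} {X' : E} (hX : HasDerivAt X X' 0) :
    HasDerivAt (fun t : ℝ => curvOp Γ (u + t • w) (X t) y z)
      (fderiv ℝ (fderiv ℝ Γ) u w (X 0) y z - fderiv ℝ (fderiv ℝ Γ) u w y (X 0) z
        + (fderiv ℝ Γ u w (X 0) (Γ u y z) + Γ u (X 0) (fderiv ℝ Γ u w y z))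
        - (fderiv ℝ Γ u w y (Γ u (X 0) z) + Γ u y (fderiv ℝ Γ u w (X 0) z))
        + curvOp Γ u X' y z) 0 := by
  have dΓ := hasDerivAt_line (differentiableAt_of_contDiffOn h.isOpen hu h.smooth_Γ) w
  have dΓ' := hasDerivAt_line (differentiableAt_of_contDiffOn h.isOpen hu
    (contDiffOn_fderiv h.isOpen h.smooth_Γ)) w
  have c := fun a : E => hasDerivAt_const (0 : ℝ) a
  have e := ((((dΓ'.clm_apply hX).clm_apply (c y)).clm_apply (c z)).sub
    (((dΓ'.clm_apply (c y)).clm_apply hX).clm_apply (c z))).add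
    ((dΓ.clm_apply hX).clm_apply ((dΓ.clm_apply (c y)).clm_apply (c z))) |>.sub
    ((dΓ.clm_apply (c y)).clm_apply ((dΓ.clm_apply hX).clm_apply (c z)))
  refine e.congr_deriv ?_
  simp only [zero_smul, add_zero, map_zero, curvOp_apply, add_apply, map_add]
  abel

/-- The derivative of the curvature along the Reeb field, by the second Bianchi identity. -/
theorem hasDerivAt_curvOp_ξ (h : IsParallelStructure U φ ξ η Γ) (hg : IsRotatingForm U φ η Γ g)
    (hnd : ∀ u ∈ U, ∀ x, (∀ y, g u x y = 0) → x = 0) {u : E} (hu : u ∈ U) (x y z : E) :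
    HasDerivAt (fun t : ℝ => curvOp Γ (u + t • ξ u) x y z)
      (curvOp Γ u (Γ u (ξ u) x) y z + curvOp Γ u x (Γ u (ξ u) y) z
        + curvOp Γ u x y (Γ u (ξ u) z) - Γ u (ξ u) (curvOp Γ u x y z)) 0 := by
  have dξ := fun w => hasDerivAt_line (differentiableAt_of_contDiffOn h.isOpen hu h.smooth_ξ) w
  -- The identity R(ξ,y)z = 0 is differentiated with ξ varying along the line. In the second Bianchi
  -- identity this kills the two terms other than D_ξ R; the claim is D_ξ R = 0 written out with
  -- Christoffel symbols.
  have key := fun w y => deriv_line_eq (g := fun _ => (0 : E)) h.isOpen hu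
    (h.hasDerivAt_curvOp hu w y z (dξ w)) (hasDerivAt_const (0 : ℝ) (0 : E))
    (fun t ht => DFunLike.congr_fun (h.curvOp_ξ hg hnd ht y) z)
  have k1 := key x y
  have k2 := key y x
  have sym := fun a b => fderiv_fderiv_symm (h.smooth_Γ.contDiffAt (h.isOpen.mem_nhds hu)) a b
  have b1 := h.curvOp_ξ hg hnd hu x
  have b2 := h.curvOp_ξ hg hnd hu y
  have c1 := DFunLike.congr_fun b1 (Γ u y z)
  have c2 := DFunLike.congr_fun b2 (Γ u x z)
  have c3 := congrArg (Γ u y) (DFunLike.congr_fun b1 z)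
  have c4 := congrArg (Γ u x) (DFunLike.congr_fun b2 z)
  refine (h.hasDerivAt_curvOp hu (ξ u) y z (hasDerivAt_const (0 : ℝ) x)).congr_deriv ?_
  rw [curvOp_swap Γ u x (Γ u (ξ u) y)]
  simp only [zero_smul, add_zero, h.fderiv_ξ u hu, curvOp_neg_left, neg_apply,
    h.Γ_symm u hu x (ξ u), h.Γ_symm u hu y (ξ u), sym (ξ u), sym y x] at k1 k2 ⊢
  have d : curvOp Γ u 0 y z = 0 := by simpa using DFunLike.congr_fun (curvOp_smul_left Γ u 0 0 y) z
  rw [d]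
  simp only [curvOp_apply Γ u x y, curvOp_apply Γ u (ξ u), map_sub, map_add, zero_apply,
    map_zero] at c1 c2 c3 c4 ⊢
  linear_combination (norm := module) k1 - k2 + c1 - c2 - c3 + c4

/-- The Lie derivative of the Ricci tensor along the Reeb field vanishes. -/
theorem hasDerivAt_ricciForm_ξ [FiniteDimensional ℝ E] (h : IsParallelStructure U φ ξ η Γ)
    (hg : IsRotatingForm U φ η Γ g)
    (hnd : ∀ u ∈ U, ∀ x, (∀ y, g u x y = 0) → x = 0) {u : E} (hu : u ∈ U) (y z : E) :
    HasDerivAt (fun t : ℝ => ricciForm Γ (u + t • ξ u) y z)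
      (ricciForm Γ u (Γ u (ξ u) y) z + ricciForm Γ u y (Γ u (ξ u) z)) 0 := by
  set b := Module.finBasis ℝ E
  have tr : ∀ f : E →ₗ[ℝ] E, LinearMap.trace ℝ E f
      = ∑ i, LinearMap.toContinuousLinearMap (b.coord i) (f (b i)) := by
    intro f
    simp [LinearMap.trace_eq_matrix_trace ℝ b, Matrix.trace, LinearMap.toMatrix_apply]
  have e : HasDerivAt (fun t : ℝ => ricciForm Γ (u + t • ξ u) y z)
      (LinearMap.trace ℝ E (curvMap Γ u y z ∘ₗ (Γ u (ξ u) : E →ₗ[ℝ] E)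
        + curvMap Γ u (Γ u (ξ u) y) z + curvMap Γ u y (Γ u (ξ u) z)
        - (Γ u (ξ u) : E →ₗ[ℝ] E) ∘ₗ curvMap Γ u y z)) 0 := by
    simp only [ricciForm]
    rw [tr]
    simp only [tr (curvMap Γ _ y z)]
    refine HasDerivAt.fun_sum fun i _ => ?_
    exact (ContinuousLinearMap.hasFDerivAt _).comp_hasDerivAt (0 : ℝ)
      (h.hasDerivAt_curvOp_ξ hg hnd hu (b i) y z)
  refine e.congr_deriv ?_
  -- The two compositions with Γ(ξ,·) have the same trace, so only the terms acting on y and z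
  -- survive.
  rw [map_sub, map_add, map_add, LinearMap.trace_comp_comm', ricciForm, ricciForm]
  ring

end IsParallelStructure

end Adapted

end AccR

namespace AccR

/-! ### Sasaki-like structures on open sets -/

section LocalSasaki

variable {E : Type*} [NormedAddCommGroup E] [NormedSpace ℝ E]
  {U : Set E} {φ : E → E →L[ℝ] E} {ξ : E → E} {η : E → E →L[ℝ] ℝ}
  {Γ Γ' : E → E →L[ℝ] E →L[ℝ] E} {k g g' : E → E →L[ℝ] E →L[ℝ] ℝ}

/-- `Γ` are the Christoffel symbols of the Levi-Civita connection of the pseudo-Riemannian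
metric `g` on `U`. -/
structure IsLeviCivita (U : Set E) (g : E → E →L[ℝ] E →L[ℝ] ℝ) (Γ : E → E →L[ℝ] E →L[ℝ] E) :
    Prop where
  isOpen : IsOpen U
  smooth_g : ContDiffOn ℝ ∞ g U
  smooth_Γ : ContDiffOn ℝ ∞ Γ U
  g_symm : ∀ u ∈ U, ∀ x y, g u x y = g u y x
  nondegenerate : ∀ u ∈ U, ∀ x, (∀ y, g u x y = 0) → x = 0
  Γ_symm : ∀ u ∈ U, ∀ x y, Γ u x y = Γ u y x
  fderiv_g : ∀ u ∈ U, ∀ w x y, fderiv ℝ g u w x y = g u (Γ u w x) y + g u x (Γ u w y)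

/-- Koszul's cyclic permutation argument at one point; it needs no linearity of `A`. It serves to
recognise the Levi-Civita connection of the associated metric in an explicit formula. -/
theorem IsLeviCivita.unique (h : IsLeviCivita U g Γ) {u : E} (hu : u ∈ U) {A : E → E → E}
    (hA : ∀ x y, A x y = A y x)
    (hg : ∀ w x y, fderiv ℝ g u w x y = g u (A w x) y + g u x (A w y)) (x y : E) :
    Γ u x y = A x y := by
  refine sub_eq_zero.1 (h.nondegenerate u hu _ fun z => ?_)
  have e : ∀ w x y, g u (A w x) y + g u x (A w y) = g u (Γ u w x) y + g u x (Γ u w y) :=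
    fun w x y => (hg w x y).symm.trans (h.fderiv_g u hu w x y)
  have e1 := e x y z
  have e2 := e y x z
  have e3 := e z x y
  rw [hA y x, h.Γ_symm u hu y x, h.g_symm u hu x, h.g_symm u hu x] at e2
  rw [hA z x, hA z y, h.Γ_symm u hu z x, h.Γ_symm u hu z y, h.g_symm u hu x, h.g_symm u hu x]
    at e3
  rw [h.g_symm u hu y, h.g_symm u hu y] at e1
  rw [map_sub, sub_apply]
  linarith

/-- A smooth almost contact structure with a compatible B-metric. -/
structure IsAlmostContactB (U : Set E) (φ : E → E →L[ℝ] E) (ξ : E → E) (η : E → E →L[ℝ] ℝ)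
    (g : E → E →L[ℝ] E →L[ℝ] ℝ) : Prop where
  smooth_φ : ContDiffOn ℝ ∞ φ U
  smooth_ξ : ContDiffOn ℝ ∞ ξ U
  smooth_η : ContDiffOn ℝ ∞ η U
  φ_ξ : ∀ u ∈ U, φ u (ξ u) = 0
  φ_φ : ∀ u ∈ U, ∀ x, φ u (φ u x) = -x + η u x • ξ u
  η_φ : ∀ u ∈ U, ∀ x, η u (φ u x) = 0
  η_ξ : ∀ u ∈ U, η u (ξ u) = 1
  g_φ_φ : ∀ u ∈ U, ∀ x y, g u (φ u x) (φ u y) = -g u x y + η u x * η u y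

/-- The Sasaki-like condition
`(∇_x φ) y = g(φ x, φ y) ξ + η(y) φ² x` for the connection with Christoffel symbols `Γ`. -/
def IsSasakiConnection (U : Set E) (φ : E → E →L[ℝ] E) (ξ : E → E) (η : E → E →L[ℝ] ℝ)
    (g : E → E →L[ℝ] E →L[ℝ] ℝ) (Γ : E → E →L[ℝ] E →L[ℝ] E) : Prop :=
  ∀ u ∈ U, ∀ x y, fderiv ℝ φ u x y + Γ u x (φ u y) - φ u (Γ u x y)
    = g u (φ u x) (φ u y) • ξ u + η u y • φ u (φ u x)

namespace IsAlmostContactB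

theorem g_ξ (h : IsAlmostContactB U φ ξ η g) {u : E} (hu : u ∈ U) (x : E) :
    g u x (ξ u) = η u x := by
  have e := h.g_φ_φ u hu x (ξ u)
  rw [h.φ_ξ u hu, map_zero, h.η_ξ u hu] at e
  linarith

theorem g_φ (h : IsAlmostContactB U φ ξ η g) {u : E} (hu : u ∈ U) (x y : E) :
    g u (φ u x) y = g u x (φ u y) := by
  have e := h.g_φ_φ u hu x (φ u y)
  rw [h.φ_φ u hu, map_add, map_neg, map_smul, h.g_ξ hu, h.η_φ u hu, h.η_φ u hu, smul_zero,
    mul_zero] at e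
  linarith

/-- `∇_w ξ = -φ w`. -/
theorem fderiv_ξ (h : IsAlmostContactB U φ ξ η g) (hL : IsLeviCivita U g Γ)
    (hS : IsSasakiConnection U φ ξ η g Γ) {u : E} (hu : u ∈ U) (w : E) :
    fderiv ℝ ξ u w = -Γ u w (ξ u) - φ u w := by
  have dφ := hasDerivAt_line (differentiableAt_of_contDiffOn hL.isOpen hu h.smooth_φ) w
  have dξ := hasDerivAt_line (differentiableAt_of_contDiffOn hL.isOpen hu h.smooth_ξ) w
  have dg := hasDerivAt_line (differentiableAt_of_contDiffOn hL.isOpen hu hL.smooth_g) w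
  have e1 := deriv_line_eq hL.isOpen hu (dφ.clm_apply dξ) (hasDerivAt_const (0 : ℝ) (0 : E))
    (fun t ht => h.φ_ξ _ ht)
  have e2 := deriv_line_eq hL.isOpen hu ((dg.clm_apply dξ).clm_apply dξ)
    (hasDerivAt_const (0 : ℝ) (1 : ℝ)) (fun t ht => by rw [h.g_ξ ht, h.η_ξ _ ht])
  have e3 := hS u hu w (ξ u)
  simp only [zero_smul, add_zero, add_apply, hL.fderiv_g u hu, h.g_ξ hu, h.φ_ξ u hu, map_zero,
    h.η_ξ u hu, one_smul, hL.g_symm u hu (ξ u), zero_add] at e1 e2 e3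
  -- The vector v = ∇_w ξ + φw satisfies φv = 0, by differentiating φξ = 0, and η(v) = 0, by
  -- differentiating g(ξ,ξ) = 1. Then φ²v = −v + η(v)ξ gives v = 0.
  set v := fderiv ℝ ξ u w + Γ u w (ξ u) + φ u w with hv
  have v1 : φ u v = 0 := by
    rw [hv, map_add, map_add]
    linear_combination (norm := module) e1 - e3
  have v2 : η u v = 0 := by
    rw [hv, map_add, map_add, h.η_φ u hu]
    linarith
  have v3 := h.φ_φ u hu v
  rw [v1, v2, map_zero, zero_smul, add_zero, zero_eq_neg] at v3
  rw [hv] at v3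
  linear_combination (norm := module) v3

/-- `(∇_w η) x = -g(φ w, x)`. -/
theorem fderiv_η (h : IsAlmostContactB U φ ξ η g) (hL : IsLeviCivita U g Γ)
    (hS : IsSasakiConnection U φ ξ η g Γ) {u : E} (hu : u ∈ U) (w x : E) :
    fderiv ℝ η u w x = η u (Γ u w x) - g u (φ u w) x := by
  have dη := hasDerivAt_line (differentiableAt_of_contDiffOn hL.isOpen hu h.smooth_η) w
  have dξ := hasDerivAt_line (differentiableAt_of_contDiffOn hL.isOpen hu h.smooth_ξ) w
  have dg := hasDerivAt_line (differentiableAt_of_contDiffOn hL.isOpen hu hL.smooth_g) w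
  have c := fun a : E => hasDerivAt_const (0 : ℝ) a
  have e := deriv_line_eq hL.isOpen hu ((dg.clm_apply (c x)).clm_apply dξ) (dη.clm_apply (c x))
    (fun t ht => h.g_ξ ht x)
  simp only [zero_smul, add_zero, hL.fderiv_g u hu, h.g_ξ hu, map_zero,
    h.fderiv_ξ hL hS hu, map_sub, map_neg] at e
  rw [hL.g_symm u hu (φ u w)]
  linarith

end IsAlmostContactB

/-- The torsion-free connection `∇_x y + η(x) φ y + η(y) φ x - g(φ x, y) ξ`, for which the
structure tensors of a Sasaki-like manifold are parallel. -/
def adaptedConnection (φ : E → E →L[ℝ] E) (ξ : E → E) (η : E → E →L[ℝ] ℝ)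
    (g : E → E →L[ℝ] E →L[ℝ] ℝ) (Γ : E → E →L[ℝ] E →L[ℝ] E) (u : E) : E →L[ℝ] E →L[ℝ] E :=
  Γ u + (η u).smulRight (φ u) + ((η u).smulRight (φ u)).flip
    - ((ContinuousLinearMap.smulRightL ℝ E E).flip (ξ u)) ∘L (g u) ∘L (φ u)

theorem adaptedConnection_apply (u x y : E) :
    adaptedConnection φ ξ η g Γ u x y
      = Γ u x y + η u x • φ u y + η u y • φ u x - g u (φ u x) y • ξ u := rfl

theorem contDiffOn_adaptedConnection [FiniteDimensional ℝ E] (h : IsAlmostContactB U φ ξ η g)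
    (hL : IsLeviCivita U g Γ) : ContDiffOn ℝ ∞ (adaptedConnection φ ξ η g Γ) U := by
  have c := fun a : E => contDiffOn_const (𝕜 := ℝ) (n := ∞) (s := U) (c := a)
  refine contDiffOn_clm_apply.2 fun x => contDiffOn_clm_apply.2 fun y => ?_
  simp only [adaptedConnection_apply]
  exact ((((hL.smooth_Γ.clm_apply (c x)).clm_apply (c y)).add
    ((h.smooth_η.clm_apply (c x)).smul (h.smooth_φ.clm_apply (c y)))).add
    ((h.smooth_η.clm_apply (c y)).smul (h.smooth_φ.clm_apply (c x)))).sub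
    (((hL.smooth_g.clm_apply (h.smooth_φ.clm_apply (c x))).clm_apply (c y)).smul h.smooth_ξ)

namespace IsAlmostContactB

/-- The correction terms are chosen to absorb the right-hand sides of the Sasaki-like formula for ∇φ
and of ∇_wξ = −φw, (∇_wη)x = −g(φw,x). They are symmetric in both arguments because φ is
g-symmetric, so no torsion appears. -/
theorem isParallelStructure [FiniteDimensional ℝ E] (h : IsAlmostContactB U φ ξ η g)
    (hL : IsLeviCivita U g Γ) (hS : IsSasakiConnection U φ ξ η g Γ) :
    IsParallelStructure U φ ξ η (adaptedConnection φ ξ η g Γ) where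
  isOpen := hL.isOpen
  smooth_φ := h.smooth_φ
  smooth_ξ := h.smooth_ξ
  smooth_η := h.smooth_η
  smooth_Γ := contDiffOn_adaptedConnection h hL
  φ_ξ := h.φ_ξ
  φ_φ := h.φ_φ
  η_φ := h.η_φ
  η_ξ := h.η_ξ
  Γ_symm u hu x y := by
    rw [adaptedConnection_apply, adaptedConnection_apply, hL.Γ_symm u hu x y, h.g_φ hu x,
      hL.g_symm u hu x]
    abel
  fderiv_φ u hu w x := by
    have e := hS u hu w x
    simp only [adaptedConnection_apply, map_add, map_sub, map_smul, h.η_φ u hu, h.φ_ξ u hu]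
    linear_combination (norm := module) e
  fderiv_ξ u hu w := by
    rw [adaptedConnection_apply, h.fderiv_ξ hL hS hu, h.φ_ξ u hu, h.η_ξ u hu, h.g_ξ hu,
      h.η_φ u hu]
    module
  fderiv_η u hu w x := by
    rw [adaptedConnection_apply, h.fderiv_η hL hS hu]
    simp [h.η_φ u hu, h.η_ξ u hu]

/-- Of the correction terms paired with g, only the two copies of η(w) g(φx,y) survive; the
remaining ones cancel through g(·,ξ) = η. -/
theorem isRotatingForm (h : IsAlmostContactB U φ ξ η g) (hL : IsLeviCivita U g Γ) :
    IsRotatingForm U φ η (adaptedConnection φ ξ η g Γ) g where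
  smooth := hL.smooth_g
  symm := hL.g_symm
  φ_symm u hu := h.g_φ hu
  fderiv_form u hu w x y := by
    simp only [adaptedConnection_apply, hL.fderiv_g u hu, map_add, map_sub, map_smul, add_apply,
      sub_apply, smul_apply, smul_eq_mul, h.g_ξ hu, hL.g_symm u hu (ξ u)]
    rw [h.g_φ hu x y, hL.g_symm u hu x (φ u w)]
    ring

end IsAlmostContactB

/-- Composition with the parallel tensor φ commutes with D. One application to g gives the form k
for ∇, a second one gives the form for the connection of g̃. -/
theorem IsRotatingForm.comp_φ (h : IsParallelStructure U φ ξ η Γ)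
    (hg : IsRotatingForm U φ η Γ g) : IsRotatingForm U φ η Γ (fun u => g u ∘L φ u) where
  smooth := hg.smooth.clm_comp h.smooth_φ
  symm u hu x y := by
    simp only [ContinuousLinearMap.comp_apply]
    rw [hg.φ_symm u hu, hg.symm u hu]
  φ_symm u hu x y := by
    simp only [ContinuousLinearMap.comp_apply]
    rw [hg.φ_symm u hu]
  fderiv_form u hu w x y := by
    have c := fun a : E => hasDerivAt_const (0 : ℝ) a
    have dφ := hasDerivAt_line (differentiableAt_of_contDiffOn h.isOpen hu h.smooth_φ) w
    have dg := hasDerivAt_line (differentiableAt_of_contDiffOn h.isOpen hu hg.smooth) w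
    have dk := hasDerivAt_line (differentiableAt_of_contDiffOn h.isOpen hu
      (hg.smooth.clm_comp h.smooth_φ)) w
    have e := deriv_line_eq h.isOpen hu ((dk.clm_apply (c x)).clm_apply (c y))
      ((dg.clm_apply (dφ.clm_apply (c x))).clm_apply (c y)) (w := w) (fun t ht => rfl)
    simp only [zero_smul, add_zero, map_zero, add_apply, hg.fderiv_form u hu,
      h.fderiv_φ u hu, map_sub, sub_apply] at e
    rw [e]
    simp only [ContinuousLinearMap.comp_apply]
    ring

/-- The Ricci tensors of the two metrics of a Sasaki-like structure, in terms of that of the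
adapted connection. -/
theorem IsAlmostContactB.ricciForm_eq [FiniteDimensional ℝ E] (h : IsAlmostContactB U φ ξ η g)
    (hL : IsLeviCivita U g Γ) (hS : IsSasakiConnection U φ ξ η g Γ)
    {n : ℕ} (hn : Module.finrank ℝ E = 2 * n + 1) {u : E} (hu : u ∈ U) (y z : E) :
    ricciForm Γ u y z
      = ricciForm (adaptedConnection φ ξ η g Γ) u y z + 2 * n * (η u y * η u z) := by
  have hP := h.isParallelStructure hL hS
  refine hP.ricciForm_eq ((h.isRotatingForm hL).comp_φ hP) (fun u hu x => ?_) hL.smooth_Γ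
    (fun u hu x y => ?_) hn hu y z
  · simp [h.g_ξ hu, h.η_φ u hu]
  · rw [adaptedConnection_apply, ContinuousLinearMap.comp_apply]
    abel

/-- Since g̃ = g(φ·,·) + η⊗η with η parallel, D g̃ is the rotation term of g(φ·,·) alone. It is
compensated by the same T with k = g(φ²·,·), so uniqueness of the Levi-Civita connection applies. -/
theorem IsAlmostContactB.ricciForm_associated_eq [FiniteDimensional ℝ E]
    (h : IsAlmostContactB U φ ξ η g)
    (hL : IsLeviCivita U g Γ) (hS : IsSasakiConnection U φ ξ η g Γ) (hL' : IsLeviCivita U g' Γ')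
    (hg' : ∀ u ∈ U, ∀ x y, g' u x y = g u x (φ u y) + η u x * η u y)
    {n : ℕ} (hn : Module.finrank ℝ E = 2 * n + 1) {u : E} (hu : u ∈ U) (y z : E) :
    ricciForm Γ' u y z
      = ricciForm (adaptedConnection φ ξ η g Γ) u y z + 2 * n * (η u y * η u z) := by
  have hP := h.isParallelStructure hL hS
  have hk1 := (h.isRotatingForm hL).comp_φ hP
  have hk := hk1.comp_φ hP
  refine hP.ricciForm_eq hk (fun u hu x => ?_) hL'.smooth_Γ (fun u hu => ?_) hn hu y z
  · simp [h.g_ξ hu, h.η_φ u hu]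
  refine hL'.unique hu (fun x y => ?_) (fun w x y => ?_)
  · rw [hP.Γ_symm u hu, hk.symm u hu]
    abel
  · have c := fun a : E => hasDerivAt_const (0 : ℝ) a
    have dη := hasDerivAt_line (differentiableAt_of_contDiffOn hL.isOpen hu h.smooth_η) w
    have dk := hasDerivAt_line (differentiableAt_of_contDiffOn hL.isOpen hu hk1.smooth) w
    have dg := hasDerivAt_line (differentiableAt_of_contDiffOn hL.isOpen hu hL'.smooth_g) w
    have e := deriv_line_eq hL.isOpen hu ((dg.clm_apply (c x)).clm_apply (c y))
      (((dk.clm_apply (c x)).clm_apply (c y)).add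
        ((dη.clm_apply (c x)).mul (dη.clm_apply (c y))))
      (fun t ht => by rw [hg' _ ht, ← h.g_φ ht]; rfl)
    simp only [zero_smul, add_zero, map_zero, hk1.fderiv_form u hu, hP.fderiv_η u hu] at e
    rw [e]
    have s1 := hk.symm u hu x w
    simp only [hg' u hu, ContinuousLinearMap.comp_apply, map_add, map_sub, map_smul, add_apply,
      sub_apply, smul_apply, smul_eq_mul, h.η_φ u hu, h.η_ξ u hu, h.φ_ξ u hu, h.g_φ hu,
      hL.g_symm u hu (ξ u)] at s1 ⊢
    rw [s1, map_zero, map_zero]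
    ring

/-- `ρ(ξ, ξ) = 2n` on a Sasaki-like manifold. -/
theorem IsAlmostContactB.ricciForm_ξ_ξ [FiniteDimensional ℝ E] (h : IsAlmostContactB U φ ξ η g)
    (hL : IsLeviCivita U g Γ) (hS : IsSasakiConnection U φ ξ η g Γ)
    {n : ℕ} (hn : Module.finrank ℝ E = 2 * n + 1) {u : E} (hu : u ∈ U) :
    ricciForm Γ u (ξ u) (ξ u) = 2 * n := by
  have e : curvMap (adaptedConnection φ ξ η g Γ) u (ξ u) (ξ u) = 0 := by
    ext x
    exact (h.isParallelStructure hL hS).curvOp_apply_ξ hu x (ξ u)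
  rw [h.ricciForm_eq hL hS hn hu, h.η_ξ u hu, ricciForm, e]
  simp

/-- If the Ricci tensor of a Sasaki-like manifold is `A g + B g̃` with `A + B = 2n` on an open set,
then `B = n` there. -/
theorem IsAlmostContactB.ricci_coefficient_eq [FiniteDimensional ℝ E]
    (h : IsAlmostContactB U φ ξ η g)
    (hL : IsLeviCivita U g Γ) (hS : IsSasakiConnection U φ ξ η g Γ)
    {n : ℕ} (hn : Module.finrank ℝ E = 2 * n + 1) {A B : E → ℝ}
    (hAB : ∀ u ∈ U, A u + B u = 2 * n)
    (hρ : ∀ u ∈ U, ∀ x y, ricciForm Γ u x y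
      = A u * g u x y + B u * (g u x (φ u y) + η u x * η u y))
    {u : E} (hu : u ∈ U) {y : E} (hy : η u y = 0) (hyy : g u y y ≠ 0) :
    B u = n := by
  have hP := h.isParallelStructure hL hS
  have hR := h.isRotatingForm hL
  -- Substituting A = 2n − B isolates the only unknown: Ric(D) − 2n(g − η⊗η) = B(g̃ − g).
  have hr : ∀ u ∈ U, ∀ x y, ricciForm (adaptedConnection φ ξ η g Γ) u x y
      - 2 * n * (g u x y - η u x * η u y)
        = B u * (g u x (φ u y) + η u x * η u y - g u x y) := by
    intro u hu x y
    have e1 := hρ u hu x y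
    rw [h.ricciForm_eq hL hS hn hu] at e1
    have e2 := hAB u hu
    have e3 : A u = 2 * n - B u := by linarith
    rw [e3] at e1
    linear_combination e1
  set Γ₀ := adaptedConnection φ ξ η g Γ
  have c := fun a : E => hasDerivAt_const (0 : ℝ) a
  have dη := hasDerivAt_line (differentiableAt_of_contDiffOn hL.isOpen hu h.smooth_η) (ξ u)
  have dφ := hasDerivAt_line (differentiableAt_of_contDiffOn hL.isOpen hu h.smooth_φ) (ξ u)
  have dg := hasDerivAt_line (differentiableAt_of_contDiffOn hL.isOpen hu hL.smooth_g) (ξ u)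
  have dP := fun y => (hP.hasDerivAt_ricciForm_ξ hR hL.nondegenerate hu y y).sub
    ((((dg.clm_apply (c y)).clm_apply (c y)).sub
      ((dη.clm_apply (c y)).mul (dη.clm_apply (c y)))).const_mul (2 * n : ℝ))
  have dE := fun y => (((dg.clm_apply (c y)).clm_apply (dφ.clm_apply (c y))).add
    ((dη.clm_apply (c y)).mul (dη.clm_apply (c y)))).sub ((dg.clm_apply (c y)).clm_apply (c y))
  -- With a = g(y,y) and b = g(y,φy), the pair (g(z,z), g(z,φz)) is (2b, −2a). This second
  -- horizontal vector makes the final relation a sum of squares.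
  set z := y + φ u y with hz
  -- B is not known to be differentiable, so it is eliminated: both sides of the previous relation,
  -- taken at y and at z, are cross-multiplied before differentiating along ξ.
  have e := deriv_line_eq hL.isOpen hu ((dP y).mul (dE z)) ((dP z).mul (dE y)) (fun t ht => by
    have e1 := hr _ ht y y
    have e2 := hr _ ht z z
    simp only [Pi.sub_apply, Pi.add_apply, Pi.mul_apply]
    rw [e1, e2]
    ring)
  simp only [Pi.sub_apply, Pi.add_apply, Pi.mul_apply, zero_smul, add_zero, map_zero,
    hR.fderiv_form u hu, hP.fderiv_η u hu, hP.fderiv_φ u hu] at e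
  have rr : ∀ x y, ricciForm Γ₀ u x y = 2 * n * (g u x y - η u x * η u y)
      + B u * (g u x (φ u y) + η u x * η u y - g u x y) := fun x y => by
    linear_combination hr u hu x y
  have q1 : ∀ x y, g u x (Γ₀ u (ξ u) y) = g u (Γ₀ u (ξ u) y) x := fun x y => hL.g_symm u hu _ _
  have q2 : ∀ x y, g u x (φ u (Γ₀ u (ξ u) y)) = g u (Γ₀ u (ξ u) y) (φ u x) := fun x y => by
    rw [← h.g_φ hu, hL.g_symm u hu]
  have hz1 : η u z = 0 := by rw [hz, map_add, hy, h.η_φ u hu, add_zero]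
  have hz2 : g u z z = 2 * g u y (φ u y) := by
    simp only [hz, map_add, add_apply, h.g_φ hu, h.φ_φ u hu, hy, zero_smul, map_neg, add_zero]
    ring
  have hz3 : g u z (φ u z) = -2 * g u y y := by
    simp only [hz, map_add, add_apply, h.g_φ hu, h.φ_φ u hu, hy, zero_smul, map_neg, add_zero]
    ring
  simp only [rr, h.g_φ hu, map_sub, q1, q2, hz1, hy, h.η_ξ u hu, h.φ_φ u hu, zero_smul, add_zero,
    map_neg] at e
  rw [hz2, hz3] at e
  -- The derivative of Ric(D) contributes only Γ-terms, which cancel; the rest comes from the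
  -- rotation of g and g(φ·,·) into each other.
  have e' : (n - B u) * (g u y y ^ 2 + g u y (φ u y) ^ 2) = 0 := by
    linear_combination (-1 / 8) * e
  have pos : g u y y ^ 2 + g u y (φ u y) ^ 2 ≠ 0 := by positivity
  linear_combination -(mul_eq_zero.1 e').resolve_right pos

end LocalSasaki

end AccR

namespace AccR

/-! ### Existence of the Levi-Civita connection on an open set -/

section Existence

variable {E : Type*} [NormedAddCommGroup E] [NormedSpace ℝ E]

/-- The right-hand side of the Koszul formula for constant vector fields. -/
def koszulForm (g : E → E →L[ℝ] E →L[ℝ] ℝ) (u : E) : E →L[ℝ] E →L[ℝ] E →L[ℝ] ℝ :=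
  fderiv ℝ g u + (fderiv ℝ g u).flip
    - (ContinuousLinearMap.flipₗᵢ ℝ E E ℝ).toContinuousLinearEquiv.toContinuousLinearMap ∘L
      (fderiv ℝ g u).flip

theorem koszulForm_apply (g : E → E →L[ℝ] E →L[ℝ] ℝ) (u x y z : E) :
    koszulForm g u x y z
      = fderiv ℝ g u x y z + fderiv ℝ g u y x z - fderiv ℝ g u z x y := rfl

/-- The Christoffel symbols of a metric on an open set. -/
def christoffel (g : E → E →L[ℝ] E →L[ℝ] ℝ) (u : E) : E →L[ℝ] E →L[ℝ] E :=
  (ContinuousLinearMap.compL ℝ E (E →L[ℝ] ℝ) E ((1 / 2 : ℝ) • (g u).inverse)) ∘L koszulForm g u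

theorem christoffel_apply (g : E → E →L[ℝ] E →L[ℝ] ℝ) (u x y : E) :
    christoffel g u x y = (1 / 2 : ℝ) • (g u).inverse (koszulForm g u x y) := rfl

variable {U : Set E} {g : E → E →L[ℝ] E →L[ℝ] ℝ}

/-- A nondegenerate form as an equivalence with the dual space. -/
theorem exists_equiv_of_nondegenerate [FiniteDimensional ℝ E] (b : E →L[ℝ] E →L[ℝ] ℝ)
    (hb : ∀ x, (∀ y, b x y = 0) → x = 0) :
    ∃ e : E ≃L[ℝ] (E →L[ℝ] ℝ), (e : E →L[ℝ] E →L[ℝ] ℝ) = b := by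
  have inj : Function.Injective (b : E →ₗ[ℝ] E →L[ℝ] ℝ) := by
    rw [← LinearMap.ker_eq_bot, LinearMap.ker_eq_bot']
    exact fun x hx => hb x fun y => by simpa using DFunLike.congr_fun hx y
  have dim : Module.finrank ℝ E = Module.finrank ℝ (E →L[ℝ] ℝ) := by
    rw [← LinearEquiv.finrank_eq (LinearMap.toContinuousLinearMap (𝕜 := ℝ) (E := E) (F' := ℝ))]
    exact (Subspace.dual_finrank_eq (K := ℝ) (V := E)).symm
  refine ⟨(LinearEquiv.ofInjectiveOfFinrankEq _ inj dim).toContinuousLinearEquiv, ?_⟩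
  rfl

theorem christoffel_koszul [FiniteDimensional ℝ E] {u : E}
    (hb : ∀ x, (∀ y, g u x y = 0) → x = 0) (x y z : E) :
    2 * g u (christoffel g u x y) z = koszulForm g u x y z := by
  obtain ⟨e, he⟩ := exists_equiv_of_nondegenerate (g u) hb
  rw [christoffel_apply, ← he, ContinuousLinearMap.inverse_equiv, map_smul]
  simp

theorem isLeviCivita_christoffel [FiniteDimensional ℝ E] (hU : IsOpen U)
    (hg : ContDiffOn ℝ ∞ g U) (hs : ∀ u ∈ U, ∀ x y, g u x y = g u y x)
    (hb : ∀ u ∈ U, ∀ x, (∀ y, g u x y = 0) → x = 0) : IsLeviCivita U g (christoffel g) := by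
  have c := fun a : E => contDiffOn_const (𝕜 := ℝ) (n := ∞) (s := U) (c := a)
  have d := contDiffOn_fderiv hU hg
  have s : ∀ u ∈ U, ∀ w x y, fderiv ℝ g u w x y = fderiv ℝ g u w y x := by
    intro u hu w x y
    have dg := hasDerivAt_line (differentiableAt_of_contDiffOn hU hu hg) w
    have c := fun a : E => hasDerivAt_const (0 : ℝ) a
    simpa using deriv_line_eq hU hu ((dg.clm_apply (c x)).clm_apply (c y))
      ((dg.clm_apply (c y)).clm_apply (c x)) (fun t ht => hs _ ht x y)
  have k := fun u (hu : u ∈ U) => christoffel_koszul (hb u hu)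
  refine ⟨hU, hg, ?_, hs, hb, fun u hu x y => ?_, fun u hu w x y => ?_⟩
  · refine contDiffOn_clm_apply.2 fun x => contDiffOn_clm_apply.2 fun y => ?_
    simp only [christoffel_apply]
    refine ContDiffOn.const_smul _ (ContDiffOn.clm_apply (fun u hu => ?_)
      (contDiffOn_clm_apply.2 fun z => ?_))
    -- `ContinuousLinearMap.inverse` is smooth at invertible maps, and nondegeneracy in finite
    -- dimension makes `g u` invertible.
    · obtain ⟨e, he⟩ := exists_equiv_of_nondegenerate (g u) (hb u hu)
      have h := contDiffAt_map_inverse (n := ∞) e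
      rw [he] at h
      exact h.comp_contDiffWithinAt u (hg u hu)
    · simp only [koszulForm_apply]
      exact ((((d.clm_apply (c x)).clm_apply (c y)).clm_apply (c z)).add
        (((d.clm_apply (c y)).clm_apply (c x)).clm_apply (c z))).sub
        (((d.clm_apply (c z)).clm_apply (c x)).clm_apply (c y))
  · refine sub_eq_zero.1 (hb u hu _ fun z => ?_)
    have e1 := k u hu x y z
    have e2 := k u hu y x z
    rw [koszulForm_apply] at e1 e2
    rw [map_sub, sub_apply]
    linarith [s u hu z x y]
  · have e1 := k u hu w x y
    have e2 := k u hu w y x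
    rw [koszulForm_apply] at e1 e2
    rw [hs u hu x]
    linarith [s u hu w x y, s u hu x w y, s u hu y w x]

end Existence

/-! ### Tensors on a manifold in a chart -/

section ChartPoint

variable {m : ℕ} {M : Type*} [TopologicalSpace M]
  [ChartedSpace (EuclideanSpace ℝ (Fin m)) M] {p₀ q : M}

theorem extChartAt_source_mem_nhds' (hq : q ∈ (chartAt (EuclideanSpace ℝ (Fin m)) p₀).source) :
    (chartAt (EuclideanSpace ℝ (Fin m)) p₀).source ∈ nhds q :=
  (chartAt _ p₀).open_source.mem_nhds hq

theorem extChartAt_mem_target (hq : q ∈ (chartAt (EuclideanSpace ℝ (Fin m)) p₀).source) :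
    extChartAt (𝓡 m) p₀ q ∈ (extChartAt (𝓡 m) p₀).target :=
  (extChartAt (𝓡 m) p₀).map_source (by rwa [extChartAt_source])

theorem extChartAt_symm_apply (hq : q ∈ (chartAt (EuclideanSpace ℝ (Fin m)) p₀).source) :
    (extChartAt (𝓡 m) p₀).symm (extChartAt (𝓡 m) p₀ q) = q :=
  (extChartAt (𝓡 m) p₀).left_inv (by rwa [extChartAt_source])

theorem extChartAt_symm_mem {u : EuclideanSpace ℝ (Fin m)}
    (hu : u ∈ (extChartAt (𝓡 m) p₀).target) :
    (extChartAt (𝓡 m) p₀).symm u ∈ (chartAt (EuclideanSpace ℝ (Fin m)) p₀).source := by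
  rw [← extChartAt_source (𝓡 m)]
  exact (extChartAt (𝓡 m) p₀).map_target hu

end ChartPoint

section Chart

variable {m : ℕ} {M : Type*} [TopologicalSpace M]
  [ChartedSpace (EuclideanSpace ℝ (Fin m)) M] [IsManifold (𝓡 m) ∞ M]

/-- The coordinates of a tangent vector in the chart at `p₀`. -/
def chartMap (p₀ q : M) : TangentSpace (𝓡 m) q →L[ℝ] EuclideanSpace ℝ (Fin m) :=
  (trivializationAt (EuclideanSpace ℝ (Fin m)) (TangentSpace (𝓡 m)) p₀).continuousLinearMapAt ℝ q

/-- The tangent vector with given coordinates in the chart at `p₀`. -/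
def chartInv (p₀ q : M) : EuclideanSpace ℝ (Fin m) →L[ℝ] TangentSpace (𝓡 m) q :=
  (trivializationAt (EuclideanSpace ℝ (Fin m)) (TangentSpace (𝓡 m)) p₀).symmL ℝ q

variable {p₀ q : M}

theorem chartInv_chartMap (hq : q ∈ (chartAt (EuclideanSpace ℝ (Fin m)) p₀).source)
    (v : TangentSpace (𝓡 m) q) : chartInv p₀ q (chartMap p₀ q v) = v :=
  Trivialization.symmL_continuousLinearMapAt _ hq v

theorem chartMap_chartInv (hq : q ∈ (chartAt (EuclideanSpace ℝ (Fin m)) p₀).source)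
    (v : EuclideanSpace ℝ (Fin m)) : chartMap p₀ q (chartInv p₀ q v) = v :=
  Trivialization.continuousLinearMapAt_symmL _ hq v

theorem chartMap_eq_mfderiv (hq : q ∈ (chartAt (EuclideanSpace ℝ (Fin m)) p₀).source) :
    chartMap p₀ q = mfderiv (𝓡 m) 𝓘(ℝ, EuclideanSpace ℝ (Fin m)) (extChartAt (𝓡 m) p₀) q :=
  TangentBundle.continuousLinearMapAt_trivializationAt hq

theorem chartMap_self (p : M) (v : TangentSpace (𝓡 m) p) : chartMap p p v = v := by
  have h : p ∈ (chartAt (EuclideanSpace ℝ (Fin m)) p).source := mem_chart_source _ p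
  have e := TangentBundle.continuousLinearMapAt_trivializationAt_eq_core (𝕜 := ℝ) (I := 𝓡 m) h
  rw [chartMap, e]
  exact (tangentBundleCore (𝓡 m) M).coordChange_self (achart _ p) p h v

/-- A vector field in the chart at `p₀`. -/
def repV (p₀ : M) (X : VField m M) (u : EuclideanSpace ℝ (Fin m)) : EuclideanSpace ℝ (Fin m) :=
  chartMap p₀ ((extChartAt (𝓡 m) p₀).symm u) (X ((extChartAt (𝓡 m) p₀).symm u))

/-- A bilinear form in the chart at `p₀`. -/
def repB (p₀ : M) (g : Bilin m M) (u : EuclideanSpace ℝ (Fin m)) :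
    EuclideanSpace ℝ (Fin m) →L[ℝ] EuclideanSpace ℝ (Fin m) →L[ℝ] ℝ :=
  ((chartInv p₀ ((extChartAt (𝓡 m) p₀).symm u)).precomp ℝ) ∘L
    (g ((extChartAt (𝓡 m) p₀).symm u)) ∘L (chartInv p₀ ((extChartAt (𝓡 m) p₀).symm u))

theorem repB_apply (g : Bilin m M) (u x y : EuclideanSpace ℝ (Fin m)) :
    repB p₀ g u x y = g ((extChartAt (𝓡 m) p₀).symm u)
      (chartInv p₀ ((extChartAt (𝓡 m) p₀).symm u) x)
      (chartInv p₀ ((extChartAt (𝓡 m) p₀).symm u) y) := rfl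

/-- Smoothness of a vector field at a point. -/
def SmoothVFieldAt (X : VField m M) (q : M) : Prop :=
  ContMDiffAt (𝓡 m) ((𝓡 m).prod 𝓘(ℝ, EuclideanSpace ℝ (Fin m))) ∞
    (fun p => TotalSpace.mk' (EuclideanSpace ℝ (Fin m)) (E := TangentSpace (𝓡 m)) p (X p)) q

/-- A function on `M` is smooth if and only if it is smooth in the chart at `p₀`. -/
theorem contMDiffAt_iff_chart {F : Type*} [NormedAddCommGroup F] [NormedSpace ℝ F] {f : M → F}
    (hq : q ∈ (chartAt (EuclideanSpace ℝ (Fin m)) p₀).source) :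
    ContMDiffAt (𝓡 m) 𝓘(ℝ, F) ∞ f q ↔
      ContDiffAt ℝ ∞ (fun u => f ((extChartAt (𝓡 m) p₀).symm u)) (extChartAt (𝓡 m) p₀ q) := by
  have ht := extChartAt_mem_target hq
  have hs : ContMDiffAt 𝓘(ℝ, EuclideanSpace ℝ (Fin m)) (𝓡 m) ∞ (extChartAt (𝓡 m) p₀).symm
      (extChartAt (𝓡 m) p₀ q) :=
    (contMDiffOn_extChartAt_symm p₀).contMDiffAt ((isOpen_extChartAt_target p₀).mem_nhds ht)
  constructor
  · intro h
    refine ContMDiffAt.contDiffAt (ContMDiffAt.comp _ (g := f) (I' := 𝓡 m) ?_ hs)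
    rwa [extChartAt_symm_apply hq]
  · intro h
    have h2 := ContMDiffAt.comp q h.contMDiffAt (contMDiffAt_extChartAt' hq)
    refine h2.congr_of_eventuallyEq ?_
    filter_upwards [extChartAt_source_mem_nhds' hq] with r hr
    rw [Function.comp_apply, extChartAt_symm_apply hr]

theorem smoothVFieldAt_iff (X : VField m M)
    (hq : q ∈ (chartAt (EuclideanSpace ℝ (Fin m)) p₀).source) :
    SmoothVFieldAt X q ↔ ContDiffAt ℝ ∞ (repV p₀ X) (extChartAt (𝓡 m) p₀ q) := by
  rw [SmoothVFieldAt, Trivialization.contMDiffAt_section_iff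
    (e := trivializationAt (EuclideanSpace ℝ (Fin m)) (TangentSpace (𝓡 m)) p₀) hq,
    contMDiffAt_iff_chart hq]
  have e : (fun u => (trivializationAt (EuclideanSpace ℝ (Fin m)) (TangentSpace (𝓡 m)) p₀
      ⟨(extChartAt (𝓡 m) p₀).symm u, X ((extChartAt (𝓡 m) p₀).symm u)⟩).2)
      =ᶠ[nhds (extChartAt (𝓡 m) p₀ q)] repV p₀ X := ?_
  · exact ⟨fun h => h.congr_of_eventuallyEq e.symm, fun h => h.congr_of_eventuallyEq e⟩
  filter_upwards [(isOpen_extChartAt_target p₀).mem_nhds (extChartAt_mem_target hq)] with u hu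
  rw [repV, chartMap, Trivialization.continuousLinearMapAt_apply,
    Trivialization.linearMapAt_apply]
  exact (if_pos (extChartAt_symm_mem hu)).symm

end Chart

end AccR

namespace AccR

/-! ### The Levi-Civita connection of a manifold in a chart -/

theorem mlieBracket_eq_lieBracket {E : Type*} [NormedAddCommGroup E] [NormedSpace ℝ E]
    (V W : ∀ x : E, TangentSpace 𝓘(ℝ, E) x) :
    VectorField.mlieBracket 𝓘(ℝ, E) V W = VectorField.lieBracket ℝ V W := by
  have e := VectorField.lieBracketWithin_univ (𝕜 := ℝ) (V := V) (W := W)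
  rw [← VectorField.mlieBracketWithin_univ]
  exact VectorField.mlieBracketWithin_eq_lieBracketWithin.trans e

section Transfer

variable {m : ℕ} {M : Type*} [TopologicalSpace M]
  [ChartedSpace (EuclideanSpace ℝ (Fin m)) M] [IsManifold (𝓡 m) ∞ M] {p₀ : M}
  {u : EuclideanSpace ℝ (Fin m)}

theorem smoothVFieldAt_symm_iff (X : VField m M) (hu : u ∈ (extChartAt (𝓡 m) p₀).target) :
    SmoothVFieldAt X ((extChartAt (𝓡 m) p₀).symm u) ↔ ContDiffAt ℝ ∞ (repV p₀ X) u := by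
  rw [smoothVFieldAt_iff X (extChartAt_symm_mem hu), (extChartAt (𝓡 m) p₀).right_inv hu]

theorem repV_chartInv (x : EuclideanSpace ℝ (Fin m)) (hu : u ∈ (extChartAt (𝓡 m) p₀).target) :
    repV p₀ (fun q => chartInv p₀ q x) u = x :=
  chartMap_chartInv (extChartAt_symm_mem hu) x

theorem smoothVFieldAt_chartInv {q : M}
    (hq : q ∈ (chartAt (EuclideanSpace ℝ (Fin m)) p₀).source) (x : EuclideanSpace ℝ (Fin m)) :
    SmoothVFieldAt (fun q => chartInv p₀ q x) q := by
  rw [smoothVFieldAt_iff _ hq]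
  refine (contDiffAt_const (c := x)).congr_of_eventuallyEq ?_
  filter_upwards [(isOpen_extChartAt_target p₀).mem_nhds (extChartAt_mem_target hq)] with u hu
  exact repV_chartInv x hu

/-- The extension has constant coordinates in the chart at its base point; this makes it smooth on
the whole chart domain. -/
theorem ext_eq_chartInv {p q : M} (hq : q ∈ (chartAt (EuclideanSpace ℝ (Fin m)) p).source)
    (v : TangentSpace (𝓡 m) p) : ext v q = chartInv p q (chartMap p p v) := by
  rw [chartMap_self]
  have e := chartMap_self p v
  rw [chartMap, Trivialization.continuousLinearMapAt_apply, Trivialization.linearMapAt_apply,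
    if_pos (FiberBundle.mem_baseSet_trivializationAt' p)] at e
  rw [ext, FiberBundle.extend, e]
  exact (Trivialization.symmL_apply (R := ℝ) (trivializationAt (EuclideanSpace ℝ (Fin m))
    (TangentSpace (𝓡 m)) p) hq v).symm

theorem ext_self {p : M} (v : TangentSpace (𝓡 m) p) : ext v p = v :=
  FiberBundle.extend_apply_self _ v

theorem eventually_smoothVFieldAt_ext {p : M} (v : TangentSpace (𝓡 m) p) :
    ∀ᶠ q in nhds p, SmoothVFieldAt (ext v) q := by
  filter_upwards [extChartAt_source_mem_nhds' (mem_chart_source (EuclideanSpace ℝ (Fin m)) p)]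
    with q hq
  refine (smoothVFieldAt_chartInv hq (chartMap p p v)).congr_of_eventuallyEq ?_
  filter_upwards [extChartAt_source_mem_nhds' hq] with r hr
  rw [ext_eq_chartInv hr]

/-- Smoothness of a field of bilinear forms. -/
def SmoothBilin (g : Bilin m M) : Prop :=
  ∀ X Y : VField m M, ∀ q, SmoothVFieldAt X q → SmoothVFieldAt Y q →
    ContMDiffAt (𝓡 m) 𝓘(ℝ, ℝ) ∞ (pair g X Y) q

theorem contDiffOn_repB {g : Bilin m M} (hg : SmoothBilin g) (p₀ : M) :
    ContDiffOn ℝ ∞ (repB p₀ g) (extChartAt (𝓡 m) p₀).target := by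
  refine contDiffOn_clm_apply.2 fun x => contDiffOn_clm_apply.2 fun y => fun u hu => ?_
  have hq := extChartAt_symm_mem hu
  have e := (contMDiffAt_iff_chart hq).1 (hg _ _ _ (smoothVFieldAt_chartInv hq x)
    (smoothVFieldAt_chartInv hq y))
  rw [(extChartAt (𝓡 m) p₀).right_inv hu] at e
  exact e.contDiffWithinAt

theorem pair_symm_apply (g : Bilin m M) (X Y : VField m M)
    (hu : u ∈ (extChartAt (𝓡 m) p₀).target) :
    pair g X Y ((extChartAt (𝓡 m) p₀).symm u) = repB p₀ g u (repV p₀ X u) (repV p₀ Y u) := by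
  rw [repB_apply, repV, repV, chartInv_chartMap (extChartAt_symm_mem hu),
    chartInv_chartMap (extChartAt_symm_mem hu)]
  rfl

theorem dirDeriv_symm_apply {f : M → ℝ} {F : EuclideanSpace ℝ (Fin m) → ℝ}
    (hu : u ∈ (extChartAt (𝓡 m) p₀).target) (hF : DifferentiableAt ℝ F u)
    (hf : ∀ v ∈ (extChartAt (𝓡 m) p₀).target, f ((extChartAt (𝓡 m) p₀).symm v) = F v)
    (X : VField m M) :
    dirDeriv f ((extChartAt (𝓡 m) p₀).symm u) (X ((extChartAt (𝓡 m) p₀).symm u))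
      = fderiv ℝ F u (repV p₀ X u) := by
  set q := (extChartAt (𝓡 m) p₀).symm u with hq'
  have hq : q ∈ (chartAt (EuclideanSpace ℝ (Fin m)) p₀).source := extChartAt_symm_mem hu
  have hqu : extChartAt (𝓡 m) p₀ q = u := (extChartAt (𝓡 m) p₀).right_inv hu
  have e : f =ᶠ[nhds q] F ∘ extChartAt (𝓡 m) p₀ := by
    filter_upwards [extChartAt_source_mem_nhds' hq] with r hr
    rw [Function.comp_apply, ← hf _ (extChartAt_mem_target hr), extChartAt_symm_apply hr]
  have d1 : HasMFDerivAt 𝓘(ℝ, EuclideanSpace ℝ (Fin m)) 𝓘(ℝ, ℝ) F (extChartAt (𝓡 m) p₀ q)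
      (fderiv ℝ F u) := by
    rw [hqu]
    exact hF.hasFDerivAt.hasMFDerivAt
  have d2 := (d1.comp q (mdifferentiableAt_extChartAt hq).hasMFDerivAt).congr_of_eventuallyEq e
  rw [dirDeriv, mvfderiv, d2.mfderiv, repV, chartMap_eq_mfderiv hq]
  rfl

/-- The Lie bracket in a chart. -/
theorem repV_bracket {X Y : VField m M} (hu : u ∈ (extChartAt (𝓡 m) p₀).target)
    (hX : SmoothVFieldAt X ((extChartAt (𝓡 m) p₀).symm u))
    (hY : SmoothVFieldAt Y ((extChartAt (𝓡 m) p₀).symm u)) :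
    repV p₀ (bracket X Y) u = VectorField.lieBracket ℝ (repV p₀ X) (repV p₀ Y) u := by
  -- The coordinate expression of a field is its pullback under the inverse chart, so naturality of
  -- the Lie bracket gives the formula.
  have key : ∀ Z : VField m M, ∀ v ∈ (extChartAt (𝓡 m) p₀).target,
      VectorField.mpullback 𝓘(ℝ, EuclideanSpace ℝ (Fin m)) (𝓡 m) (extChartAt (𝓡 m) p₀).symm Z v
        = repV p₀ Z v := by
    intro Z v hv
    have h1 := mfderiv_extChartAt_comp_mfderivWithin_extChartAt_symm (I := 𝓡 m) hv
    have h2 := mfderivWithin_extChartAt_symm_comp_mfderiv_extChartAt (I := 𝓡 m) hv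
    rw [ModelWithCorners.range_eq_univ, mfderivWithin_univ] at h1 h2
    rw [VectorField.mpullback_apply, ContinuousLinearMap.inverse_eq h2 h1, repV,
      chartMap_eq_mfderiv (extChartAt_symm_mem hv)]
    rfl
  have : IsManifold (𝓡 m) (minSmoothness ℝ 2) M := by
    rw [minSmoothness_of_isRCLikeNormedField]
    infer_instance
  have hs : ContMDiffAt 𝓘(ℝ, EuclideanSpace ℝ (Fin m)) (𝓡 m) ∞ (extChartAt (𝓡 m) p₀).symm u :=
    (contMDiffOn_extChartAt_symm p₀).contMDiffAt ((isOpen_extChartAt_target p₀).mem_nhds hu)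
  have e := VectorField.mpullback_mlieBracket (hX.mdifferentiableAt (by simp))
    (hY.mdifferentiableAt (by simp)) hs (by simpa using ENat.LEInfty.out)
  rw [key _ u hu] at e
  have ev : ∀ Z : VField m M, VectorField.mpullback 𝓘(ℝ, EuclideanSpace ℝ (Fin m)) (𝓡 m)
      (extChartAt (𝓡 m) p₀).symm Z =ᶠ[nhds u] repV p₀ Z := fun Z => by
    filter_upwards [(isOpen_extChartAt_target p₀).mem_nhds hu] with v hv
    exact key Z v hv
  exact (e.trans ((ev X).mlieBracket_vectorField_eq (ev Y))).trans
    (congrFun (mlieBracket_eq_lieBracket _ _) u)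

theorem differentiableAt_repV {X : VField m M} (hu : u ∈ (extChartAt (𝓡 m) p₀).target)
    (hX : SmoothVFieldAt X ((extChartAt (𝓡 m) p₀).symm u)) :
    DifferentiableAt ℝ (repV p₀ X) u :=
  ((smoothVFieldAt_symm_iff X hu).1 hX).differentiableAt (by simp)

variable {g : Bilin m M}

/-- The Koszul formula in a chart. -/
theorem koszul_symm_apply (hg : SmoothBilin g) (hs : ∀ p x y, g p x y = g p y x)
    {X Y Z : VField m M} (hu : u ∈ (extChartAt (𝓡 m) p₀).target)
    (hX : SmoothVFieldAt X ((extChartAt (𝓡 m) p₀).symm u))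
    (hY : SmoothVFieldAt Y ((extChartAt (𝓡 m) p₀).symm u))
    (hZ : SmoothVFieldAt Z ((extChartAt (𝓡 m) p₀).symm u)) :
    koszul g X Y Z ((extChartAt (𝓡 m) p₀).symm u)
      = koszulForm (repB p₀ g) u (repV p₀ X u) (repV p₀ Y u) (repV p₀ Z u)
        + 2 * repB p₀ g u (fderiv ℝ (repV p₀ Y) u (repV p₀ X u)) (repV p₀ Z u) := by
  have dg : DifferentiableAt ℝ (repB p₀ g) u :=
    differentiableAt_of_contDiffOn (isOpen_extChartAt_target p₀) hu (contDiffOn_repB hg p₀)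
  have s : ∀ x y, repB p₀ g u x y = repB p₀ g u y x := fun x y => hs _ _ _
  have d : ∀ {X Y : VField m M} (Z : VField m M),
      SmoothVFieldAt X ((extChartAt (𝓡 m) p₀).symm u) →
      SmoothVFieldAt Y ((extChartAt (𝓡 m) p₀).symm u) →
      dirDeriv (pair g X Y) ((extChartAt (𝓡 m) p₀).symm u) (Z ((extChartAt (𝓡 m) p₀).symm u))
        = fderiv ℝ (repB p₀ g) u (repV p₀ Z u) (repV p₀ X u) (repV p₀ Y u)
          + repB p₀ g u (fderiv ℝ (repV p₀ X) u (repV p₀ Z u)) (repV p₀ Y u)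
          + repB p₀ g u (repV p₀ X u) (fderiv ℝ (repV p₀ Y) u (repV p₀ Z u)) := by
    intro X Y Z hX hY
    have h := (dg.hasFDerivAt.clm_apply (differentiableAt_repV hu hX).hasFDerivAt).clm_apply
      (differentiableAt_repV hu hY).hasFDerivAt
    rw [dirDeriv_symm_apply hu h.differentiableAt (fun v hv => pair_symm_apply g X Y hv) Z,
      h.fderiv]
    simp
    ring
  have b : ∀ {X Y : VField m M} (Z : VField m M),
      SmoothVFieldAt X ((extChartAt (𝓡 m) p₀).symm u) →
      SmoothVFieldAt Y ((extChartAt (𝓡 m) p₀).symm u) →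
      g ((extChartAt (𝓡 m) p₀).symm u) (bracket X Y ((extChartAt (𝓡 m) p₀).symm u))
        (Z ((extChartAt (𝓡 m) p₀).symm u))
        = repB p₀ g u (fderiv ℝ (repV p₀ Y) u (repV p₀ X u)) (repV p₀ Z u)
          - repB p₀ g u (fderiv ℝ (repV p₀ X) u (repV p₀ Y u)) (repV p₀ Z u) := by
    intro X Y Z hX hY
    have e := pair_symm_apply g (bracket X Y) Z hu
    rw [repV_bracket hu hX hY, VectorField.lieBracket_eq] at e
    rw [← sub_apply, ← map_sub]
    exact e
  -- By symmetry of g all derivatives of `X` and `Z` cancel, and that of `Y` along `X` is counted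
  -- twice.
  rw [koszul, d X hY hZ, d Y hX hZ, d Z hX hY, b Z hX hY, b Y hX hZ, b X hY hZ, koszulForm_apply,
    s (repV p₀ Y u) (fderiv ℝ (repV p₀ Z) u (repV p₀ X u)),
    s (repV p₀ X u) (fderiv ℝ (repV p₀ Z) u (repV p₀ Y u)),
    s (repV p₀ X u) (fderiv ℝ (repV p₀ Y) u (repV p₀ Z u))]
  ring

/-- The Levi-Civita connection in a chart. -/
theorem repV_leviCivita (hg : SmoothBilin g) (hs : ∀ p x y, g p x y = g p y x)
    (hn : ∀ p x, (∀ y, g p x y = 0) → x = 0)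
    {X Y : VField m M} (hu : u ∈ (extChartAt (𝓡 m) p₀).target)
    (hX : SmoothVFieldAt X ((extChartAt (𝓡 m) p₀).symm u))
    (hY : SmoothVFieldAt Y ((extChartAt (𝓡 m) p₀).symm u)) :
    repV p₀ (leviCivita g X Y) u
      = covD (christoffel (repB p₀ g)) (repV p₀ X) (repV p₀ Y) u := by
  have hq := extChartAt_symm_mem hu
  set G := repB p₀ g
  set q := (extChartAt (𝓡 m) p₀).symm u with hqdef
  have hnG : ∀ x, (∀ y, G u x y = 0) → x = 0 := by
    intro x hx
    have e := hn q (chartInv p₀ q x) fun y => by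
      have := hx (chartMap p₀ q y)
      rwa [repB_apply, chartInv_chartMap hq] at this
    rw [← chartMap_chartInv hq x, e, map_zero]
  set w := chartInv p₀ q (covD (christoffel G) (repV p₀ X) (repV p₀ Y) u) with hw
  -- The coordinate covariant derivative is a witness, so the `epsilon` in `leviCivita` does satisfy
  -- its specification; nondegeneracy identifies the two vectors.
  have hP : ∀ z : TangentSpace (𝓡 m) q, 2 * g q w z = koszul g X Y (ext z) q := by
    intro z
    have e := koszul_symm_apply hg hs hu hX hY (eventually_smoothVFieldAt_ext z).self_of_nhds
    have ez : repV p₀ (ext z) u = chartMap p₀ q z := by rw [repV, ← hqdef, ext_self]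
    have e2 : g q w z = G u (covD (christoffel G) (repV p₀ X) (repV p₀ Y) u) (chartMap p₀ q z) := by
      rw [repB_apply, chartInv_chartMap hq]
    rw [e, ez, e2, covD, map_add, add_apply, ← christoffel_koszul hnG]
    ring
  have hspec := Classical.epsilon_spec
    (p := fun w : TangentSpace (𝓡 m) q => ∀ z, 2 * g q w z = koszul g X Y (ext z) q) ⟨w, hP⟩
  have hu : leviCivita g X Y q = w := by
    refine sub_eq_zero.1 (hn q _ fun z => ?_)
    rw [map_sub, sub_apply]
    have e1 : 2 * g q (leviCivita g X Y q) z = _ := hspec z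
    have e2 := hP z
    linarith
  rw [repV, ← hqdef, hu, hw, chartMap_chartInv hq]

end Transfer

end AccR

namespace AccR

/-! ### The curvature of a manifold in a chart -/

section CurvatureTransfer

variable {m : ℕ} {M : Type*} [TopologicalSpace M]
  [ChartedSpace (EuclideanSpace ℝ (Fin m)) M] [IsManifold (𝓡 m) ∞ M] {p₀ : M}
  {u : EuclideanSpace ℝ (Fin m)} {g : Bilin m M}

theorem isLeviCivita_repB (hg : SmoothBilin g) (hs : ∀ p x y, g p x y = g p y x)
    (hn : ∀ p x, (∀ y, g p x y = 0) → x = 0) (p₀ : M) :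
    IsLeviCivita (extChartAt (𝓡 m) p₀).target (repB p₀ g) (christoffel (repB p₀ g)) := by
  refine isLeviCivita_christoffel (isOpen_extChartAt_target p₀) (contDiffOn_repB hg p₀)
    (fun u _ x y => hs _ _ _) fun u hu x hx => ?_
  have hq := extChartAt_symm_mem hu
  have e := hn _ (chartInv p₀ _ x) fun y => by
    have := hx (chartMap p₀ _ y)
    rwa [repB_apply, chartInv_chartMap hq] at this
  rw [← chartMap_chartInv hq x, e, map_zero]

theorem contDiffAt_covD {E : Type*} [NormedAddCommGroup E] [NormedSpace ℝ E]
    {Γ : E → E →L[ℝ] E →L[ℝ] E} {X Y : E → E} {u : E} (hΓ : ContDiffAt ℝ ∞ Γ u)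
    (hX : ContDiffAt ℝ ∞ X u) (hY : ContDiffAt ℝ ∞ Y u) : ContDiffAt ℝ ∞ (covD Γ X Y) u :=
  ((hY.fderiv_right le_rfl).clm_apply hX).add ((hΓ.clm_apply hX).clm_apply hY)

theorem covD_congr {E : Type*} [NormedAddCommGroup E] [NormedSpace ℝ E]
    {Γ : E → E →L[ℝ] E →L[ℝ] E} {X X' Y Y' : E → E} {u : E} (hX : X u = X' u)
    (hY : Y =ᶠ[nhds u] Y') : covD Γ X Y u = covD Γ X' Y' u := by
  rw [covD, covD, hX, hY.fderiv_eq, hY.self_of_nhds]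

/-- The curvature in a chart. -/
theorem repV_curvField (hg : SmoothBilin g) (hs : ∀ p x y, g p x y = g p y x)
    (hn : ∀ p x, (∀ y, g p x y = 0) → x = 0)
    {X Y Z : VField m M} (hu : u ∈ (extChartAt (𝓡 m) p₀).target)
    (hX : ∀ᶠ q in nhds ((extChartAt (𝓡 m) p₀).symm u), SmoothVFieldAt X q)
    (hY : ∀ᶠ q in nhds ((extChartAt (𝓡 m) p₀).symm u), SmoothVFieldAt Y q)
    (hZ : ∀ᶠ q in nhds ((extChartAt (𝓡 m) p₀).symm u), SmoothVFieldAt Z q) :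
    repV p₀ (curvField g X Y Z) u
      = curvOp (christoffel (repB p₀ g)) u (repV p₀ X u) (repV p₀ Y u) (repV p₀ Z u) := by
  have hL := isLeviCivita_repB hg hs hn p₀
  have hΓ : ContDiffAt ℝ ∞ (christoffel (repB p₀ g)) u :=
    hL.smooth_Γ.contDiffAt (hL.isOpen.mem_nhds hu)
  have hc : ContinuousAt (extChartAt (𝓡 m) p₀).symm u := continuousAt_extChartAt_symm'' hu
  -- Equality near `u`, not only at `u`, is required because the outer connection differentiates
  -- this field.
  have ev : ∀ {V W : VField m M},
      (∀ᶠ q in nhds ((extChartAt (𝓡 m) p₀).symm u), SmoothVFieldAt V q) →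
      (∀ᶠ q in nhds ((extChartAt (𝓡 m) p₀).symm u), SmoothVFieldAt W q) →
      repV p₀ (leviCivita g V W)
        =ᶠ[nhds u] covD (christoffel (repB p₀ g)) (repV p₀ V) (repV p₀ W) := by
    intro V W hV hW
    filter_upwards [hL.isOpen.mem_nhds hu, hc.eventually hV, hc.eventually hW] with v h1 h2 h3
    exact repV_leviCivita hg hs hn h1 h2 h3
  have sm : ∀ {V : VField m M},
      (∀ᶠ q in nhds ((extChartAt (𝓡 m) p₀).symm u), SmoothVFieldAt V q) →
      ContDiffAt ℝ ∞ (repV p₀ V) u := fun hV => (smoothVFieldAt_symm_iff _ hu).1 hV.self_of_nhds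
  have two : ∀ {V W K : VField m M},
      (∀ᶠ q in nhds ((extChartAt (𝓡 m) p₀).symm u), SmoothVFieldAt V q) →
      (∀ᶠ q in nhds ((extChartAt (𝓡 m) p₀).symm u), SmoothVFieldAt W q) →
      (∀ᶠ q in nhds ((extChartAt (𝓡 m) p₀).symm u), SmoothVFieldAt K q) →
      repV p₀ (leviCivita g V (leviCivita g W K)) u
        = covD (christoffel (repB p₀ g)) (repV p₀ V)
            (covD (christoffel (repB p₀ g)) (repV p₀ W) (repV p₀ K)) u := by
    intro V W K hV hW hK
    rw [repV_leviCivita hg hs hn hu hV.self_of_nhds ((smoothVFieldAt_symm_iff _ hu).2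
      ((contDiffAt_covD hΓ (sm hW) (sm hK)).congr_of_eventuallyEq (ev hW hK)))]
    exact covD_congr rfl (ev hW hK)
  have br := repV_bracket hu hX.self_of_nhds hY.self_of_nhds
  have sb : SmoothVFieldAt (bracket X Y) ((extChartAt (𝓡 m) p₀).symm u) := by
    refine (smoothVFieldAt_symm_iff _ hu).2 (ContDiffAt.congr_of_eventuallyEq
      (f := VectorField.lieBracket ℝ (repV p₀ X) (repV p₀ Y)) ?_ ?_)
    · exact (((sm hY).fderiv_right le_rfl).clm_apply (sm hX)).sub
        (((sm hX).fderiv_right le_rfl).clm_apply (sm hY))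
    · filter_upwards [hL.isOpen.mem_nhds hu, hc.eventually hX, hc.eventually hY] with v h1 h2 h3
      exact repV_bracket h1 h2 h3
  have three : repV p₀ (leviCivita g (bracket X Y) Z) u
      = covD (christoffel (repB p₀ g)) (VectorField.lieBracket ℝ (repV p₀ X) (repV p₀ Y))
          (repV p₀ Z) u := by
    rw [repV_leviCivita hg hs hn hu sb hZ.self_of_nhds]
    exact covD_congr br (Filter.EventuallyEq.refl _ _)
  have split : repV p₀ (curvField g X Y Z) u
      = repV p₀ (leviCivita g X (leviCivita g Y Z)) u
        - repV p₀ (leviCivita g Y (leviCivita g X Z)) u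
        - repV p₀ (leviCivita g (bracket X Y) Z) u := by
    simp only [repV, curvField, Pi.sub_apply, map_sub]
  rw [split, two hX hY hZ, two hY hX hZ, three]
  exact covD_covD_sub (hΓ.differentiableAt (by simp)) ((sm hX).differentiableAt (by simp))
    ((sm hY).differentiableAt (by simp)) (sm hZ)

theorem fderiv_fun_clm_apply {E : Type*} [NormedAddCommGroup E] [NormedSpace ℝ E]
    {φ : E → E →L[ℝ] E} {Y : E → E} {u : E} (hφ : DifferentiableAt ℝ φ u)
    (hY : DifferentiableAt ℝ Y u) (x : E) :
    fderiv ℝ (fun v => φ v (Y v)) u x = fderiv ℝ φ u x (Y u) + φ u (fderiv ℝ Y u x) := by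
  rw [(hφ.hasFDerivAt.clm_apply hY.hasFDerivAt).fderiv, add_comm]
  rfl

/-- The linear isomorphism of a tangent space with the model space given by a chart. -/
def chartEquiv {q : M} (hq : q ∈ (chartAt (EuclideanSpace ℝ (Fin m)) p₀).source) :
    TangentSpace (𝓡 m) q ≃ₗ[ℝ] EuclideanSpace ℝ (Fin m) :=
  (ContinuousLinearEquiv.equivOfInverse (chartMap p₀ q) (chartInv p₀ q)
    (chartInv_chartMap hq) (chartMap_chartInv hq)).toLinearEquiv

/-- The Ricci tensor in a chart. -/
theorem ricci_symm_apply (hg : SmoothBilin g) (hs : ∀ p x y, g p x y = g p y x)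
    (hn : ∀ p x, (∀ y, g p x y = 0) → x = 0) (hu : u ∈ (extChartAt (𝓡 m) p₀).target)
    (y z : TangentSpace (𝓡 m) ((extChartAt (𝓡 m) p₀).symm u)) :
    ricci g ((extChartAt (𝓡 m) p₀).symm u) y z
      = ricciForm (christoffel (repB p₀ g)) u
          (chartMap p₀ ((extChartAt (𝓡 m) p₀).symm u) y)
          (chartMap p₀ ((extChartAt (𝓡 m) p₀).symm u) z) := by
  have hq := extChartAt_symm_mem hu
  set K := curvMap (christoffel (repB p₀ g)) u
    (chartMap p₀ ((extChartAt (𝓡 m) p₀).symm u) y)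
    (chartMap p₀ ((extChartAt (𝓡 m) p₀).symm u) z) with hK
  have key : ∀ x : TangentSpace (𝓡 m) ((extChartAt (𝓡 m) p₀).symm u),
      curv g ((extChartAt (𝓡 m) p₀).symm u) x y z = (chartEquiv hq).symm.conj K x := by
    intro x
    have e := repV_curvField hg hs hn hu
      (eventually_smoothVFieldAt_ext x) (eventually_smoothVFieldAt_ext y)
      (eventually_smoothVFieldAt_ext z)
    rw [repV, repV, repV, repV, ext_self, ext_self, ext_self] at e
    have e2 := chartInv_chartMap hq (curvField g (ext x) (ext y) (ext z)
      ((extChartAt (𝓡 m) p₀).symm u))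
    rw [e] at e2
    exact e2.symm
  -- The chart at p₀ may differ from the preferred chart at the point, which defines `stdBasis`;
  -- invariance of the trace under conjugation bridges the two.
  have e := LinearMap.trace_conj' K (chartEquiv hq).symm
  rw [ricciForm, ← hK, ← e, LinearMap.trace_eq_matrix_trace ℝ (stdBasis _), Matrix.trace]
  refine Finset.sum_congr rfl fun i _ => ?_
  rw [Matrix.diag_apply, LinearMap.toMatrix_apply, key]

end CurvatureTransfer

/-! ### Almost contact complex Riemannian structures in a chart -/

namespace AccRStructure

variable {n : ℕ} {M : Type*} [TopologicalSpace M]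
  [ChartedSpace (EuclideanSpace ℝ (Fin (2 * n + 1))) M] [IsManifold (𝓡 (2 * n + 1)) ∞ M]
  (S : AccRStructure n M)

theorem smoothVFieldAt_φ {X : VField (2 * n + 1) M} {q : M} (hX : SmoothVFieldAt X q) :
    SmoothVFieldAt (fun p => S.φ p (X p)) q :=
  ContMDiffAt.clm_bundle_apply (F₁ := EuclideanSpace ℝ (Fin (2 * n + 1)))
    (F₂ := EuclideanSpace ℝ (Fin (2 * n + 1))) (S.smooth_φ q) hX

theorem contMDiffAt_η {X : VField (2 * n + 1) M} {q : M} (hX : SmoothVFieldAt X q) :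
    ContMDiffAt (𝓡 (2 * n + 1)) 𝓘(ℝ, ℝ) ∞ (fun p => S.η p (X p)) q := by
  have : ContMDiffAt (𝓡 (2 * n + 1)) ((𝓡 (2 * n + 1)).prod 𝓘(ℝ)) ∞
      (fun p => TotalSpace.mk' ℝ (E := Bundle.Trivial M ℝ) p (S.η p (X p))) q :=
    ContMDiffAt.clm_bundle_apply (F₁ := EuclideanSpace ℝ (Fin (2 * n + 1))) (F₂ := ℝ)
      (S.smooth_η q) hX
  rw [contMDiffAt_totalSpace] at this
  exact this.2

theorem smoothBilin_g : SmoothBilin S.g := by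
  intro X Y q hX hY
  have : ContMDiffAt (𝓡 (2 * n + 1)) ((𝓡 (2 * n + 1)).prod 𝓘(ℝ)) ∞
      (fun p => TotalSpace.mk' ℝ (E := Bundle.Trivial M ℝ) p (S.g p (X p) (Y p))) q :=
    ContMDiffAt.clm_bundle_apply₂ (F₁ := EuclideanSpace ℝ (Fin (2 * n + 1)))
      (F₂ := EuclideanSpace ℝ (Fin (2 * n + 1))) (F₃ := ℝ) (S.smooth_g q) hX hY
  rw [contMDiffAt_totalSpace] at this
  exact this.2

theorem smoothBilin_gTilde : SmoothBilin S.gTilde := by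
  intro X Y q hX hY
  have e : pair S.gTilde X Y
      = fun p => pair S.g X (fun p => S.φ p (Y p)) p + S.η p (X p) * S.η p (Y p) :=
    funext fun p => S.gTilde_apply p _ _
  rw [e]
  exact (S.smoothBilin_g _ _ q hX (S.smoothVFieldAt_φ hY)).add
    ((S.contMDiffAt_η hX).mul (S.contMDiffAt_η hY))

theorem g_ξ (p : M) (x : TangentSpace (𝓡 (2 * n + 1)) p) : S.g p x (S.ξ p) = S.η p x := by
  have e := S.g_φ_φ p x (S.ξ p)
  rw [S.φ_ξ, map_zero, S.η_ξ] at e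
  linarith

theorem g_φ_left (p : M) (x y : TangentSpace (𝓡 (2 * n + 1)) p) :
    S.g p (S.φ p x) y = S.g p x (S.φ p y) := by
  have e := S.g_φ_φ p x (S.φ p y)
  rw [S.φ_φ, S.η_φ, map_add, map_neg, map_smul, S.g_ξ, S.η_φ, smul_zero] at e
  linarith

theorem g_nondegenerate (p : M) (x : TangentSpace (𝓡 (2 * n + 1)) p)
    (hx : ∀ y, S.g p x y = 0) : x = 0 := by
  obtain ⟨b, h1, h2, h3⟩ := S.g_signature p
  have e : ∀ j, S.g p x (b j) = b.repr x j * S.g p (b j) (b j) := by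
    intro j
    conv_lhs => rw [← b.sum_repr x]
    rw [map_sum, sum_apply, Finset.sum_eq_single j]
    · simp
    · intro i _ hij
      simp [h1 i j hij]
    · simp
  refine b.ext_elem fun j => ?_
  have := e j
  rw [hx] at this
  rcases j with j | j
  · rw [h2] at this
    simpa using this.symm
  · rw [h3] at this
    simpa using this.symm

theorem gTilde_symm (p : M) (x y : TangentSpace (𝓡 (2 * n + 1)) p) :
    S.gTilde p x y = S.gTilde p y x := by
  rw [gTilde_apply, gTilde_apply, ← S.g_φ_left, S.g_symm, mul_comm (S.η p x)]

theorem gTilde_nondegenerate (p : M) (x : TangentSpace (𝓡 (2 * n + 1)) p)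
    (hx : ∀ y, S.gTilde p x y = 0) : x = 0 := by
  refine S.g_nondegenerate p x fun y => ?_
  -- This test vector v satisfies g̃(x,v) = g(x,y).
  have e := hx (-S.φ p y + S.η p y • S.ξ p)
  rw [gTilde_apply] at e
  simp only [map_add, map_neg, map_smul, S.φ_φ, S.φ_ξ, S.η_φ, S.η_ξ, S.g_ξ, smul_eq_mul] at e
  simp at e
  linarith

/-- The endomorphism field in the chart at `p₀`. -/
def repφ (p₀ : M) (u : EuclideanSpace ℝ (Fin (2 * n + 1))) :
    EuclideanSpace ℝ (Fin (2 * n + 1)) →L[ℝ] EuclideanSpace ℝ (Fin (2 * n + 1)) :=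
  chartMap p₀ ((extChartAt (𝓡 (2 * n + 1)) p₀).symm u)
    ∘L S.φ ((extChartAt (𝓡 (2 * n + 1)) p₀).symm u)
    ∘L chartInv p₀ ((extChartAt (𝓡 (2 * n + 1)) p₀).symm u)

/-- The contact form in the chart at `p₀`. -/
def repη (p₀ : M) (u : EuclideanSpace ℝ (Fin (2 * n + 1))) :
    EuclideanSpace ℝ (Fin (2 * n + 1)) →L[ℝ] ℝ :=
  S.η ((extChartAt (𝓡 (2 * n + 1)) p₀).symm u)
    ∘L chartInv p₀ ((extChartAt (𝓡 (2 * n + 1)) p₀).symm u)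

theorem repφ_apply (p₀ : M) (u x : EuclideanSpace ℝ (Fin (2 * n + 1))) :
    S.repφ p₀ u x = chartMap p₀ ((extChartAt (𝓡 (2 * n + 1)) p₀).symm u)
      (S.φ ((extChartAt (𝓡 (2 * n + 1)) p₀).symm u)
        (chartInv p₀ ((extChartAt (𝓡 (2 * n + 1)) p₀).symm u) x)) := rfl

theorem repη_apply (p₀ : M) (u x : EuclideanSpace ℝ (Fin (2 * n + 1))) :
    S.repη p₀ u x = S.η ((extChartAt (𝓡 (2 * n + 1)) p₀).symm u)
      (chartInv p₀ ((extChartAt (𝓡 (2 * n + 1)) p₀).symm u) x) := rfl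

theorem chartInv_repφ {p₀ : M} {u : EuclideanSpace ℝ (Fin (2 * n + 1))}
    (hu : u ∈ (extChartAt (𝓡 (2 * n + 1)) p₀).target)
    (x : EuclideanSpace ℝ (Fin (2 * n + 1))) :
    chartInv p₀ ((extChartAt (𝓡 (2 * n + 1)) p₀).symm u) (S.repφ p₀ u x)
      = S.φ ((extChartAt (𝓡 (2 * n + 1)) p₀).symm u)
        (chartInv p₀ ((extChartAt (𝓡 (2 * n + 1)) p₀).symm u) x) := by
  rw [repφ_apply, chartInv_chartMap (extChartAt_symm_mem hu)]

theorem repV_φ {p₀ : M} {u : EuclideanSpace ℝ (Fin (2 * n + 1))}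
    (hu : u ∈ (extChartAt (𝓡 (2 * n + 1)) p₀).target) (X : VField (2 * n + 1) M) :
    repV p₀ (fun q => S.φ q (X q)) u = S.repφ p₀ u (repV p₀ X u) := by
  rw [repφ_apply, repV, repV, chartInv_chartMap (extChartAt_symm_mem hu)]

theorem contDiffOn_repφ (p₀ : M) :
    ContDiffOn ℝ ∞ (S.repφ p₀) (extChartAt (𝓡 (2 * n + 1)) p₀).target := by
  refine contDiffOn_clm_apply.2 fun x u hu => ContDiffAt.contDiffWithinAt ?_
  exact (smoothVFieldAt_symm_iff _ hu).1
    (S.smoothVFieldAt_φ (smoothVFieldAt_chartInv (extChartAt_symm_mem hu) x))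

theorem contDiffOn_repη (p₀ : M) :
    ContDiffOn ℝ ∞ (S.repη p₀) (extChartAt (𝓡 (2 * n + 1)) p₀).target := by
  refine contDiffOn_clm_apply.2 fun x u hu => ContDiffAt.contDiffWithinAt ?_
  have hq := extChartAt_symm_mem hu
  have e := (contMDiffAt_iff_chart hq).1 (S.contMDiffAt_η (smoothVFieldAt_chartInv hq x))
  rw [(extChartAt (𝓡 (2 * n + 1)) p₀).right_inv hu] at e
  exact e

theorem isAlmostContactB_rep (p₀ : M) :
    IsAlmostContactB (extChartAt (𝓡 (2 * n + 1)) p₀).target (S.repφ p₀) (repV p₀ S.ξ)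
      (S.repη p₀) (repB p₀ S.g) where
  smooth_φ := S.contDiffOn_repφ p₀
  smooth_ξ u hu := ((smoothVFieldAt_symm_iff _ hu).1 (S.smooth_ξ _)).contDiffWithinAt
  smooth_η := S.contDiffOn_repη p₀
  φ_ξ u hu := by rw [← S.repV_φ hu, repV, S.φ_ξ, map_zero]
  φ_φ u hu x := by
    rw [repφ_apply, S.chartInv_repφ hu, S.φ_φ, map_add, map_neg, map_smul,
      chartMap_chartInv (extChartAt_symm_mem hu)]
    rfl
  η_φ u hu x := by rw [repη_apply, S.chartInv_repφ hu, S.η_φ]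
  η_ξ u hu := by rw [repη_apply, repV, chartInv_chartMap (extChartAt_symm_mem hu), S.η_ξ]
  g_φ_φ u hu x y := by
    rw [repB_apply, S.chartInv_repφ hu, S.chartInv_repφ hu, S.g_φ_φ]
    rfl

theorem isLeviCivita_g (p₀ : M) : IsLeviCivita (extChartAt (𝓡 (2 * n + 1)) p₀).target
    (repB p₀ S.g) (christoffel (repB p₀ S.g)) :=
  isLeviCivita_repB S.smoothBilin_g S.g_symm S.g_nondegenerate p₀

theorem isLeviCivita_gTilde (p₀ : M) : IsLeviCivita (extChartAt (𝓡 (2 * n + 1)) p₀).target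
    (repB p₀ S.gTilde) (christoffel (repB p₀ S.gTilde)) :=
  isLeviCivita_repB S.smoothBilin_gTilde S.gTilde_symm S.gTilde_nondegenerate p₀

theorem repB_gTilde (p₀ : M) {u : EuclideanSpace ℝ (Fin (2 * n + 1))}
    (hu : u ∈ (extChartAt (𝓡 (2 * n + 1)) p₀).target)
    (x y : EuclideanSpace ℝ (Fin (2 * n + 1))) :
    repB p₀ S.gTilde u x y
      = repB p₀ S.g u x (S.repφ p₀ u y) + S.repη p₀ u x * S.repη p₀ u y := by
  rw [repB_apply, repB_apply, S.chartInv_repφ hu, gTilde_apply]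
  rfl

variable {S}

/-- The covariant derivative of `φ` on a Sasaki-like manifold. -/
theorem IsSasakiLike.leviCivita_φ (hS : S.IsSasakiLike) (p : M)
    (x y : TangentSpace (𝓡 (2 * n + 1)) p) :
    leviCivita S.g (ext x) (fun q => S.φ q (ext y q)) p - S.φ p (leviCivita S.g (ext x) (ext y) p)
      = S.g p (S.φ p x) (S.φ p y) • S.ξ p + S.η p y • S.φ p (S.φ p x) := by
  refine sub_eq_zero.1 (S.g_nondegenerate p _ fun z => ?_)
  have e := hS p x y z
  rw [F] at e
  rw [map_sub, sub_apply, e, map_add, map_smul, map_smul, add_apply, smul_apply, smul_apply,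
    S.g_symm p (S.ξ p), S.g_ξ, S.g_φ_left p (S.φ p x), smul_eq_mul, smul_eq_mul]
  ring

/-- The tensor F is evaluated on extensions that need not be constant in the chart at p₀. By the
product rule, the derivative of the extension of y occurs in both ∇_x(φy) and φ(∇_x y) and cancels.
-/
theorem IsSasakiLike.isSasakiConnection (hS : S.IsSasakiLike) (p₀ : M) :
    IsSasakiConnection (extChartAt (𝓡 (2 * n + 1)) p₀).target (S.repφ p₀) (repV p₀ S.ξ)
      (S.repη p₀) (repB p₀ S.g) (christoffel (repB p₀ S.g)) := by
  intro u hu x y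
  have hq := extChartAt_symm_mem hu
  set q := (extChartAt (𝓡 (2 * n + 1)) p₀).symm u with hqdef
  have r : ∀ v : EuclideanSpace ℝ (Fin (2 * n + 1)), repV p₀ (ext (chartInv p₀ q v)) u = v := by
    intro v
    rw [repV, ← hqdef, ext_self, chartMap_chartInv hq]
  have s : ∀ v : EuclideanSpace ℝ (Fin (2 * n + 1)),
      SmoothVFieldAt (ext (chartInv p₀ q v)) q :=
    fun v => (eventually_smoothVFieldAt_ext _).self_of_nhds
  have e := congrArg (chartMap p₀ q) (hS.leviCivita_φ q (chartInv p₀ q x) (chartInv p₀ q y))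
  have e1 := repV_leviCivita S.smoothBilin_g S.g_symm S.g_nondegenerate hu (s x) (s y)
  have e2 := repV_leviCivita S.smoothBilin_g S.g_symm S.g_nondegenerate hu (s x)
    (S.smoothVFieldAt_φ (s y))
  have dφ : DifferentiableAt ℝ (S.repφ p₀) u :=
    differentiableAt_of_contDiffOn (isOpen_extChartAt_target p₀) hu (S.contDiffOn_repφ p₀)
  have e3 : fderiv ℝ (repV p₀ fun q' => S.φ q' (ext (chartInv p₀ q y) q')) u x
      = fderiv ℝ (S.repφ p₀) u x y
        + S.repφ p₀ u (fderiv ℝ (repV p₀ (ext (chartInv p₀ q y))) u x) := by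
    have ev : (repV p₀ fun q' => S.φ q' (ext (chartInv p₀ q y) q'))
        =ᶠ[nhds u] fun v => S.repφ p₀ v (repV p₀ (ext (chartInv p₀ q y)) v) := by
      filter_upwards [(isOpen_extChartAt_target p₀).mem_nhds hu] with v hv
      exact S.repV_φ hv _
    rw [ev.fderiv_eq, fderiv_fun_clm_apply dφ (differentiableAt_repV hu (s y)), r]
  rw [covD, r, r] at e1
  rw [covD, S.repV_φ hu, r, r, e3] at e2
  have e4 := S.repV_φ hu (leviCivita S.g (ext (chartInv p₀ q x)) (ext (chartInv p₀ q y)))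
  rw [e1, map_add] at e4
  rw [map_sub, map_add, map_smul, map_smul] at e
  have e5 : chartMap p₀ q (S.φ q (S.φ q (chartInv p₀ q x))) = S.repφ p₀ u (S.repφ p₀ u x) := by
    rw [S.repφ_apply p₀ u (S.repφ p₀ u x), S.chartInv_repφ hu]
  have e6 : S.g q (S.φ q (chartInv p₀ q x)) (S.φ q (chartInv p₀ q y))
      = repB p₀ S.g u (S.repφ p₀ u x) (S.repφ p₀ u y) := by
    rw [repB_apply, S.chartInv_repφ hu, S.chartInv_repφ hu]
  rw [e5, e6] at e
  have e7 : repV p₀ (leviCivita S.g (ext (chartInv p₀ q x))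
        (fun q' => S.φ q' (ext (chartInv p₀ q y) q'))) u
      - repV p₀ (fun q' => S.φ q' (leviCivita S.g (ext (chartInv p₀ q x))
        (ext (chartInv p₀ q y)) q')) u
      = repB p₀ S.g u (S.repφ p₀ u x) (S.repφ p₀ u y) • repV p₀ S.ξ u
        + S.repη p₀ u y • S.repφ p₀ u (S.repφ p₀ u x) := e
  rw [e2, e4] at e7
  rw [← e7]
  abel

theorem finrank_model :
    Module.finrank ℝ (EuclideanSpace ℝ (Fin (2 * n + 1))) = 2 * n + 1 := by simp

/-- The metrics `g` and `g̃` of a Sasaki-like manifold have the same Ricci tensor. -/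
theorem IsSasakiLike.ricci_gTilde (hS : S.IsSasakiLike) (p : M)
    (x y : TangentSpace (𝓡 (2 * n + 1)) p) : ricci S.gTilde p x y = ricci S.g p x y := by
  have hp := mem_chart_source (EuclideanSpace ℝ (Fin (2 * n + 1))) p
  have hu := extChartAt_mem_target hp
  have key : ∀ x y, ricci S.gTilde ((extChartAt (𝓡 (2 * n + 1)) p).symm
      (extChartAt (𝓡 (2 * n + 1)) p p)) x y
      = ricci S.g ((extChartAt (𝓡 (2 * n + 1)) p).symm (extChartAt (𝓡 (2 * n + 1)) p p)) x y := by
    intro x y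
    rw [ricci_symm_apply S.smoothBilin_g S.g_symm S.g_nondegenerate hu,
      ricci_symm_apply S.smoothBilin_gTilde S.gTilde_symm S.gTilde_nondegenerate hu,
      (S.isAlmostContactB_rep p).ricciForm_eq (S.isLeviCivita_g p) (hS.isSasakiConnection p)
        finrank_model hu,
      (S.isAlmostContactB_rep p).ricciForm_associated_eq (S.isLeviCivita_g p)
        (hS.isSasakiConnection p) (S.isLeviCivita_gTilde p) (fun u hu => S.repB_gTilde p hu)
        finrank_model hu]
  rw [extChartAt_symm_apply hp] at key
  exact key x y

theorem IsSasakiLike.ricci_ξ_ξ (hS : S.IsSasakiLike) (p : M) :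
    ricci S.g p (S.ξ p) (S.ξ p) = 2 * n := by
  have hp := mem_chart_source (EuclideanSpace ℝ (Fin (2 * n + 1))) p
  have hu := extChartAt_mem_target hp
  have key := (S.isAlmostContactB_rep p).ricciForm_ξ_ξ (S.isLeviCivita_g p)
    (hS.isSasakiConnection p) finrank_model hu
  have e := ricci_symm_apply S.smoothBilin_g S.g_symm S.g_nondegenerate hu
    (S.ξ ((extChartAt (𝓡 (2 * n + 1)) p).symm (extChartAt (𝓡 (2 * n + 1)) p p)))
    (S.ξ ((extChartAt (𝓡 (2 * n + 1)) p).symm (extChartAt (𝓡 (2 * n + 1)) p p)))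
  have e2 := e.trans key
  rw [extChartAt_symm_apply hp] at e2
  exact e2

variable (S) in
-- Otherwise polarisation makes g vanish on ker η, and g(·,ξ) = η then puts ker η in the radical, so
-- ker η = 0. Every vector would be a multiple of ξ, with g(ξ,ξ) = 1, contradicting the negative
-- basis vector that exists for n ≥ 1.
theorem exists_η_eq_zero_g_ne_zero (hn : 1 ≤ n) (p : M) :
    ∃ y : TangentSpace (𝓡 (2 * n + 1)) p, S.η p y = 0 ∧ S.g p y y ≠ 0 := by
  by_contra! h
  obtain ⟨b, h1, h2, h3⟩ := S.g_signature p
  have hd : ∀ x y, S.η p x = 0 → S.g p x y = 0 := by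
    intro x y hx
    have e : ∀ y, S.η p y = 0 → S.g p x y = 0 := by
      intro y hy
      have e := h (x + y) (by rw [map_add, hx, hy, add_zero])
      rw [map_add, map_add, add_apply, add_apply, h x hx, h y hy, S.g_symm p y x] at e
      linarith
    have e1 := e (y - S.η p y • S.ξ p) (by rw [map_sub, map_smul, S.η_ξ]; simp)
    rw [map_sub, map_smul, S.g_ξ, hx, smul_zero, sub_zero] at e1
    exact e1
  have hz : ∀ x, S.η p x = 0 → x = 0 := fun x hx => S.g_nondegenerate p x fun y => hd x y hx
  have hb : ∀ x, x = S.η p x • S.ξ p := fun x =>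
    sub_eq_zero.1 (hz _ (by rw [map_sub, map_smul, S.η_ξ]; simp))
  have e3 := h3 ⟨0, hn⟩
  rw [hb (b (Sum.inr ⟨0, hn⟩))] at e3
  rw [map_smul, map_smul, smul_apply, S.g_ξ, S.η_ξ] at e3
  simp only [smul_eq_mul, mul_one] at e3
  nlinarith [mul_self_nonneg (S.η p (b (Sum.inr ⟨0, hn⟩)))]

/-- If the Ricci tensor of a Sasaki-like manifold is `A g + B g̃` with `A + B = 2n`, then
`B = n`. -/
theorem IsSasakiLike.ricci_coefficient_eq (hS : S.IsSasakiLike) (hn : 1 ≤ n) {A B : M → ℝ}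
    (hAB : ∀ p, A p + B p = 2 * n)
    (hρ : ∀ p x y, ricci S.g p x y = A p * S.g p x y + B p * S.gTilde p x y) (p : M) :
    B p = n := by
  have hp := mem_chart_source (EuclideanSpace ℝ (Fin (2 * n + 1))) p
  have hu := extChartAt_mem_target hp
  have hr := extChartAt_symm_apply hp
  obtain ⟨y, hy, hyy⟩ := S.exists_η_eq_zero_g_ne_zero hn
    ((extChartAt (𝓡 (2 * n + 1)) p).symm (extChartAt (𝓡 (2 * n + 1)) p p))
  have e := (S.isAlmostContactB_rep p).ricci_coefficient_eq (S.isLeviCivita_g p)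
    (hS.isSasakiConnection p) finrank_model
    (A := fun u => A ((extChartAt (𝓡 (2 * n + 1)) p).symm u))
    (B := fun u => B ((extChartAt (𝓡 (2 * n + 1)) p).symm u)) (fun u _ => hAB _)
    (fun u hu x y => ?_) hu (y := chartMap p _ y) ?_ ?_
  · rwa [hr] at e
  · have e := ricci_symm_apply S.smoothBilin_g S.g_symm S.g_nondegenerate hu
      (chartInv p _ x) (chartInv p _ y)
    rw [chartMap_chartInv (extChartAt_symm_mem hu), chartMap_chartInv (extChartAt_symm_mem hu),
      hρ] at e
    rw [← e, ← S.repB_gTilde p hu]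
    rfl
  · rw [repη_apply, chartInv_chartMap (extChartAt_symm_mem hu), hy]
  · rwa [repB_apply, chartInv_chartMap (extChartAt_symm_mem hu)]

end AccRStructure

end AccR

namespace AccR

/-! ### Scalar curvatures -/

/-- The trace of a bilinear form `g(·, Q ·)` with respect to `g` is the trace of `Q`. -/
theorem metricTrace_eq_trace {m : ℕ} {M : Type*} [TopologicalSpace M]
    [ChartedSpace (EuclideanSpace ℝ (Fin m)) M] {g : Bilin m M} {p : M}
    (hs : ∀ x y, g p x y = g p y x) (hn : ∀ x, (∀ y, g p x y = 0) → x = 0)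
    {B : TangentSpace (𝓡 m) p → TangentSpace (𝓡 m) p → ℝ}
    (Q : TangentSpace (𝓡 m) p →ₗ[ℝ] TangentSpace (𝓡 m) p) (hB : ∀ x y, B x y = g p x (Q y)) :
    metricTrace g p B = LinearMap.trace ℝ (TangentSpace (𝓡 m) p) Q := by
  rw [metricTrace]
  set G := Matrix.of fun i j => g p (stdBasis p i) (stdBasis p j) with hG
  have hGs : G.transpose = G := by
    ext i j
    exact hs _ _
  -- A null vector of the Gram matrix would lie in the radical of g. Invertibility makes `G⁻¹` a
  -- true inverse instead of its default value 0.
  have hdet : IsUnit G.det := by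
    rw [isUnit_iff_ne_zero]
    intro h
    obtain ⟨v, hv, h0⟩ := Matrix.exists_mulVec_eq_zero_iff.2 h
    refine hv ?_
    have hx : ∑ j, v j • stdBasis p j = 0 := by
      refine hn _ fun y => ?_
      rw [hs, ← (stdBasis p).sum_repr y]
      generalize (stdBasis p).repr y = c
      rw [map_sum (g p), sum_apply]
      refine Finset.sum_eq_zero fun i _ => ?_
      have e := congrFun h0 i
      rw [Matrix.mulVec, dotProduct] at e
      simp only [hG, Matrix.of_apply, Pi.zero_apply] at e
      rw [map_smul, smul_apply, map_sum]
      simp only [map_smul, smul_eq_mul]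
      simp only [mul_comm (v _), e, mul_zero]
    exact funext (Fintype.linearIndependent_iff.1 (stdBasis p).linearIndependent v hx)
  have hBm : ∀ i j, B (stdBasis p i) (stdBasis p j)
      = (G * LinearMap.toMatrix (stdBasis p) (stdBasis p) Q) i j := by
    intro i j
    rw [hB, ← (stdBasis p).sum_repr (Q (stdBasis p j)), map_sum, Matrix.mul_apply]
    refine Finset.sum_congr rfl fun k _ => ?_
    rw [map_smul, smul_eq_mul, mul_comm, LinearMap.toMatrix_apply]
    rfl
  have hi : G⁻¹.transpose = G⁻¹ := by rw [Matrix.transpose_nonsing_inv, hGs]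
  rw [LinearMap.trace_eq_matrix_trace ℝ (stdBasis p),
    ← Matrix.nonsing_inv_mul_cancel_left G (LinearMap.toMatrix (stdBasis p) (stdBasis p) Q) hdet,
    Matrix.trace, Finset.sum_comm]
  refine Finset.sum_congr rfl fun j _ => ?_
  rw [Matrix.diag_apply, Matrix.mul_apply]
  refine Finset.sum_congr rfl fun i _ => ?_
  rw [hBm, ← hi, Matrix.transpose_apply, hi]

theorem trace_smul_id_add {E : Type*} [NormedAddCommGroup E] [NormedSpace ℝ E]
    [FiniteDimensional ℝ E] {φ : E →ₗ[ℝ] E} (hφ : ∀ x, φ (φ (φ x)) = -φ x) {η : E →ₗ[ℝ] ℝ} {ξ : E}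
    (hη : η ξ = 1) (a b c : ℝ) :
    LinearMap.trace ℝ E (a • LinearMap.id + b • φ + c • η.smulRight ξ)
      = Module.finrank ℝ E * a + c := by
  rw [map_add, map_add, map_smul, map_smul, map_smul, LinearMap.trace_id,
    trace_eq_zero_of_cube_eq_neg φ hφ, LinearMap.trace_smulRight, hη]
  simp only [smul_eq_mul]
  ring

namespace AccRStructure

variable {n : ℕ} {M : Type*} [TopologicalSpace M]
  [ChartedSpace (EuclideanSpace ℝ (Fin (2 * n + 1))) M] [IsManifold (𝓡 (2 * n + 1)) ∞ M]
  {S : AccRStructure n M} {p : M} {A B : ℝ}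

variable (S) in
/-- The endomorphism `a id + b φ + c η ⊗ ξ`. -/
def endo (p : M) (a b c : ℝ) :
    TangentSpace (𝓡 (2 * n + 1)) p →ₗ[ℝ] TangentSpace (𝓡 (2 * n + 1)) p :=
  a • LinearMap.id + b • (S.φ p : TangentSpace (𝓡 (2 * n + 1)) p →ₗ[ℝ] _)
    + c • (S.η p : TangentSpace (𝓡 (2 * n + 1)) p →ₗ[ℝ] ℝ).smulRight (S.ξ p)

theorem endo_apply (a b c : ℝ) (x : TangentSpace (𝓡 (2 * n + 1)) p) :
    S.endo p a b c x = a • x + b • S.φ p x + c • S.η p x • S.ξ p := rfl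

theorem trace_endo (a b c : ℝ) :
    LinearMap.trace ℝ (TangentSpace (𝓡 (2 * n + 1)) p) (S.endo p a b c)
      = (2 * n + 1) * a + c := by
  have e := trace_smul_id_add (E := EuclideanSpace ℝ (Fin (2 * n + 1)))
    (φ := (S.φ p : TangentSpace (𝓡 (2 * n + 1)) p →ₗ[ℝ] TangentSpace (𝓡 (2 * n + 1)) p))
    (fun x => ?_) (η := (S.η p : TangentSpace (𝓡 (2 * n + 1)) p →ₗ[ℝ] ℝ)) (ξ := S.ξ p)
    (S.η_ξ p) a b c
  · rw [finrank_model] at e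
    push_cast at e
    exact e
  · have e : S.φ p (S.φ p (S.φ p x)) = -S.φ p x + S.η p (S.φ p x) • S.ξ p := S.φ_φ p _
    have e0 : S.η p (S.φ p x) = 0 := S.η_φ p x
    rw [e0, zero_smul, add_zero] at e
    exact e

/-- Here ρ = g(·,Q·) with Q = A id + Bφ + B η⊗ξ, and φ is traceless. -/
theorem tau_eq (hρ : ∀ x y, ricci S.g p x y = A * S.g p x y + B * S.gTilde p x y) :
    S.tau p = (2 * n + 1) * A + B := by
  rw [tau, scalarCurv, metricTrace_eq_trace (S.g_symm p) (S.g_nondegenerate p) (S.endo p A B B)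
    fun x y => ?_, trace_endo]
  rw [hρ, gTilde_apply, endo_apply, map_add, map_add, map_smul, map_smul, map_smul, map_smul,
    S.g_ξ]
  simp only [smul_eq_mul]
  ring

theorem tauTilde_eq
    (hρ : ∀ x y, ricci S.gTilde p x y = A * S.g p x y + B * S.gTilde p x y) :
    S.tauTilde p = A + (2 * n + 1) * B := by
  rw [tauTilde, scalarCurv, metricTrace_eq_trace (S.gTilde_symm p) (S.gTilde_nondegenerate p)
    (S.endo p B (-A) A) fun x y => ?_, trace_endo, add_comm]
  -- Hence g = g̃(·,(−φ + η⊗ξ)·), which explains the coefficients B, −A, A of the endomorphism.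
  have e1 : S.gTilde p x (S.φ p y) = -S.g p x y + S.η p x * S.η p y := by
    rw [gTilde_apply, S.φ_φ, S.η_φ, map_add, map_neg, map_smul, S.g_ξ, smul_eq_mul]
    ring
  have e2 : S.gTilde p x (S.ξ p) = S.η p x := by
    rw [gTilde_apply, S.φ_ξ, S.η_ξ, map_zero, zero_add, mul_one]
  rw [hρ, endo_apply, map_add, map_add, map_smul, map_smul, map_smul, map_smul, e1, e2]
  simp only [smul_eq_mul]
  ring

theorem gTilde_ξ_ξ : S.gTilde p (S.ξ p) (S.ξ p) = 1 := by
  rw [gTilde_apply, S.φ_ξ, S.η_ξ, map_zero]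
  norm_num

/-- The Ricci tensor at a point at which the soliton and conformality equations hold. -/
theorem SolitonEqAt.ricci_eq {β : ℝ} {θ : VField (2 * n + 1) M} {lam lam' ψ ψ' : M → ℝ}
    (h : S.SolitonEqAt β θ lam lam' p) (hψ : IsConformalAt θ S.g ψ p)
    (hψ' : IsConformalAt θ S.gTilde ψ' p) (x y : TangentSpace (𝓡 (2 * n + 1)) p) :
    ricci S.g p x y = -(ψ p + lam p + β * S.tau p) * S.g p x y
      + -(ψ' p + lam' p + β * S.tauTilde p) * S.gTilde p x y := by
  have e := h x y
  rw [rho, hψ x y, hψ' x y] at e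
  linear_combination e

theorem IsSasakiLike.coefficient_add (hS : S.IsSasakiLike)
    (hρ : ∀ x y, ricci S.g p x y = A * S.g p x y + B * S.gTilde p x y) : A + B = 2 * n := by
  have e := hρ (S.ξ p) (S.ξ p)
  rw [hS.ricci_ξ_ξ, S.g_ξ, S.η_ξ, gTilde_ξ_ξ] at e
  linarith

end AccRStructure

end AccR

end

/-! ### The theorem: algebra at a point, then constancy of the coefficients. -/

theorem theorem1 (n : ℕ) (hn : 1 ≤ n) {M : Type*} [TopologicalSpace M] [T2Space M]
    [SecondCountableTopology M] [ChartedSpace (EuclideanSpace ℝ (Fin (2 * n + 1))) M]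
    [IsManifold (𝓡 (2 * n + 1)) ∞ M] (S : AccR.AccRStructure n M) (hS : S.IsSasakiLike)
    (β : ℝ) (θ : AccR.VField (2 * n + 1) M) (hθ : AccR.SmoothVField θ)
    (lam lam' ψ ψ' : M → ℝ) :
    -- the theorem for an almost soliton on all of `M`
    (S.IsRBLikeAlmostSoliton β θ lam lam' → AccR.IsConformal θ S.g ψ →
      AccR.IsConformal θ S.gTilde ψ' →
        S.IsEinsteinLike ∧
        (∀ p, S.RicciFormulaAt p) ∧
        (∀ p, S.tau p + S.tauTilde p = 4 * n * (n + 1)) ∧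
        (β ≠ -1 / (2 * n) →
          (∀ p, S.tau p = -(2 * n) / (1 + 2 * n * β) * (ψ p + lam p - 1)) ∧
          (∀ p, S.tauTilde p = -(2 * n) / (1 + 2 * n * β) * (ψ' p + lam' p - 1)) ∧
          (∀ p, ψ p + lam p + ψ' p + lam' p + 2 * n * (1 + 2 * (n + 1) * β) = 0)) ∧
        (β = -1 / (2 * n) →
          (∀ p, ψ p + lam p = 1) ∧ (∀ p, ψ' p + lam' p = 1))) ∧
    -- the same formulas at each single point at which the equations of the hypothesis hold
    (∀ p, S.SolitonEqAt β θ lam lam' p → AccR.IsConformalAt θ S.g ψ p →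
      AccR.IsConformalAt θ S.gTilde ψ' p →
        S.RicciFormulaAt p ∧
        S.tau p + S.tauTilde p = 4 * n * (n + 1) ∧
        (β ≠ -1 / (2 * n) →
          S.tau p = -(2 * n) / (1 + 2 * n * β) * (ψ p + lam p - 1) ∧
          S.tauTilde p = -(2 * n) / (1 + 2 * n * β) * (ψ' p + lam' p - 1) ∧
          ψ p + lam p + ψ' p + lam' p + 2 * n * (1 + 2 * (n + 1) * β) = 0) ∧
        (β = -1 / (2 * n) → ψ p + lam p = 1 ∧ ψ' p + lam' p = 1)) := by
  have n0 : (n : ℝ) ≠ 0 := by positivity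
  have pointwise : ∀ p, S.SolitonEqAt β θ lam lam' p → AccR.IsConformalAt θ S.g ψ p →
      AccR.IsConformalAt θ S.gTilde ψ' p →
        S.RicciFormulaAt p ∧
        S.tau p + S.tauTilde p = 4 * n * (n + 1) ∧
        (β ≠ -1 / (2 * n) →
          S.tau p = -(2 * n) / (1 + 2 * n * β) * (ψ p + lam p - 1) ∧
          S.tauTilde p = -(2 * n) / (1 + 2 * n * β) * (ψ' p + lam' p - 1) ∧
          ψ p + lam p + ψ' p + lam' p + 2 * n * (1 + 2 * (n + 1) * β) = 0) ∧
        (β = -1 / (2 * n) → ψ p + lam p = 1 ∧ ψ' p + lam' p = 1) := by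
    intro p h hψ hψ'
    have hρ := h.ricci_eq hψ hψ'
    have hAB := hS.coefficient_add hρ
    have hτ := AccR.AccRStructure.tau_eq hρ
    -- The trace defining τ̃ is that of the Ricci tensor of g̃, which equals ρ on a Sasaki-like
    -- manifold.
    have hτ' := AccR.AccRStructure.tauTilde_eq
      (fun x y => (hS.ricci_gTilde p x y).trans (hρ x y))
    set A := -(ψ p + lam p + β * S.tau p) with hA
    set B := -(ψ' p + lam' p + β * S.tauTilde p) with hB
    have t : S.tau p = 2 * n * (A + 1) := by linear_combination hτ + hAB
    have t' : S.tauTilde p = 2 * n * (B + 1) := by linear_combination hτ' + hAB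
    -- A itself contains −βτ; moving this term to the left produces the factor 1 + 2nβ, whose
    -- vanishing separates the two cases.
    have k : (1 + 2 * n * β) * S.tau p = -(2 * n) * (ψ p + lam p - 1) := by
      linear_combination t + 2 * n * hA
    have k' : (1 + 2 * n * β) * S.tauTilde p = -(2 * n) * (ψ' p + lam' p - 1) := by
      linear_combination t' + 2 * n * hB
    have s : S.tau p + S.tauTilde p = 4 * n * (n + 1) := by
      linear_combination t + t' + 2 * n * hAB
    refine ⟨fun x y => ?_, s, fun hβ => ?_, fun hβ => ?_⟩
    · have eA : S.tau p / (2 * n) - 1 = A := by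
        rw [t]
        field_simp
        ring
      have eB : S.tauTilde p / (2 * n) - 1 = B := by
        rw [t']
        field_simp
        ring
      rw [eA, eB]
      exact hρ x y
    · have hd : (1 + 2 * n * β : ℝ) ≠ 0 := fun h0 => hβ (by
        field_simp
        linarith)
      refine ⟨?_, ?_, ?_⟩
      · field_simp
        linear_combination k
      · field_simp
        linear_combination k'
      · refine mul_left_cancel₀ n0 ?_
        linear_combination (k + k' - (1 + 2 * n * β) * s) / 2
    · have hd : (1 + 2 * n * β : ℝ) = 0 := by
        rw [hβ]
        field_simp
        ring
      rw [hd, zero_mul] at k k'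
      constructor
      · refine mul_left_cancel₀ n0 ?_
        linear_combination k / 2
      · refine mul_left_cancel₀ n0 ?_
        linear_combination k' / 2
  refine ⟨fun h hψ hψ' => ?_, pointwise⟩
  have all := fun p => pointwise p (h p) (hψ p) (hψ' p)
  refine ⟨?_, fun p => (all p).1, fun p => (all p).2.1, fun hβ => ?_, fun hβ => ?_⟩
  · have hρ := fun p => (h p).ricci_eq (hψ p) (hψ' p)
    have hAB := fun p => hS.coefficient_add (hρ p)
    have hB := hS.ricci_coefficient_eq hn hAB hρ
    -- B = n and A + B = 2n give ρ = n g + n g̃.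
    refine ⟨n, n, 0, fun p x y => ?_⟩
    have e := hρ p x y
    rw [hB p, (by linarith [hAB p, hB p] : -(ψ p + lam p + β * S.tau p) = n)] at e
    rw [AccR.AccRStructure.rho, e]
    ring
  · exact ⟨fun p => ((all p).2.2.1 hβ).1, fun p => ((all p).2.2.1 hβ).2.1,
      fun p => ((all p).2.2.1 hβ).2.2⟩
  · exact ⟨fun p => ((all p).2.2.2 hβ).1, fun p => ((all p).2.2.2 hβ).2⟩
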